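/- Let $R$ be a binomial domain, i.e. an integral domain of characteristic zero in which for every $a\in R$ and every positive integer $k$ the equation $a(a-1)\cdots(a-k+1)=k!\,x$ has a (unique) solution $x=\binom ak$. Let $r,c\ge 2$, and let $\mathbf u=(u_{11},\dots,u_{1n_1},u_{21},\dots,u_{cn_c})$ be a Hall basic sequence of a free nilpotent group $N_{r,c}(\mathbb Z)$ of rank $r$ and class $c$: $u_{11},\dots,u_{1n_1}$ ($n_1=r$) are free generators, each $u_{ij}$ is a commutator of weight $i$ in them, and for $1\le i\le c$ the classes of $u_{i1},\dots,u_{in_i}$ freely generate the abelian group $\Gamma_i/\Gamma_{i+1}$. Let $p_{ij}(\mathbf x,\mathbf y)$ and $q_{ij}(\mathbf x,y)$ be the associated canonical polynomials, i.e. the integer combinations of products of binomial coefficients in the variables such that $\mathbf u^{\mathbf a}\mathbf u^{\mathbf b}=\mathbf u^{p(\mathbf a,\mathbf b)}$ and $(\mathbf u^{\mathbf a})^l=\mathbf u^{q(\mathbf a,l)}$ for all integer tuples $\mathbf a,\mathbf b$ and all $l\in\mathbb Z$, where $\mathbf u^{\mathbf a}=u_{11}^{a_{11}}\cdots u_{cn_c}^{a_{cn_c}}$.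 Let $G=N_{r,c}(R)$ be the set of formal products $\mathbf u^{\mathbf a}$ with exponents $a_{ij}\in R$, with product $\mathbf u^{\mathbf a}\mathbf u^{\mathbf b}=\mathbf u^{p(\mathbf a,\mathbf b)}$ and inverse $(\mathbf u^{\mathbf a})^{-1}=\mathbf u^{q(\mathbf a,-1)}$. For $1\le k\le r$ let $f^k=(f^k_1,\dots,f^k_{n_c})\colon R^+\times R^+\to (R^+)^{n_c}$ be a symmetric 2-cocycle, i.e. $f^k(x+y,z)+f^k(x,y)=f^k(x,y+z)+f^k(y,z)$, $f^k(0,x)=f^k(x,0)=0$ and $f^k(x,y)=f^k(y,x)$. Let $N_{r,c}(R,\bar f)$ be the same set of formal products, with the product $\mathbf u^{\mathbf a}\mathbf u^{\mathbf b}=\mathbf u^{\mathbf d}$ and the inverse $(\mathbf u^{\mathbf a})^{-1}=\mathbf u^{\mathbf m}$, where for $i<c$ one puts $d_{ij}=p_{ij}(\mathbf a,\mathbf b)$, $m_{ij}=q_{ij}(\mathbf a,-1)$, and $$d_{cj}=p_{cj}(\mathbf a,\mathbf b)+\sum_{k=1}^r f^k_j(a_{1k},b_{1k}),\qquad m_{cj}=q_{cj}(\mathbf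 a,-1)-\sum_{k=1}^r f^k_j(a_{1k},-a_{1k}).$$ Then $G$ is a group, and $N_{r,c}(R,\bar f)$ is a group with the product and the inverse just defined. Write $\mathbf u_c^{\mathbf v}=u_{c1}^{v_1}\cdots u_{cn_c}^{v_{n_c}}$, let $\mathbf a_c$ be the tuple of the exponents of weight $c$ of $\mathbf a$, and let $\mathbf a'$ be $\mathbf a$ with these exponents replaced by $0$. The formula $$k(\mathbf u^{\mathbf a}Z(G),\mathbf u^{\mathbf b}Z(G))=\mathbf u_c^{\,p_c(\mathbf a',\mathbf b')+\sum_{i=1}^r f^i(a_{1i},b_{1i})}$$ gives a well-defined 2-cocycle $k\colon G/Z(G)\times G/Z(G)\to Z(G)$ (for the trivial action, with $k(1,x)=k(x,1)=1$), and $N_{r,c}(R,\bar f)$ is the central extension of $Z(G)$ by $G/Z(G)$ via $k$. Explicitly, let $E(k)$ be the set $G/Z(G)\times Z(G)$ with the product $(b_1,z_1)(b_2,z_2)=(b_1b_2,\,z_1z_2\,k(b_1,b_2))$. The maps $\mathbf u^{\mathbf z}\mapsto\mathbf u^{\mathbf z}$ and $\mathbf u^{\mathbf a}\mapsto\mathbf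 u^{\mathbf a}Z(G)$ form a short exact sequence of groups $1\to Z(G)\to N_{r,c}(R,\bar f)\to G/Z(G)\to 1$ in which the image of $Z(G)$ is the centre of $N_{r,c}(R,\bar f)$, and $\mathbf u^{\mathbf a}\mapsto(\mathbf u^{\mathbf a}Z(G),\mathbf u_c^{\mathbf a_c})$ is an isomorphism from this extension onto the extension $1\to Z(G)\to E(k)\to G/Z(G)\to 1$. -/

import Mathlib

/-! ### Free nilpotent groups and Hall basic sequences -/

/-- The indices of weight `k`. The double index `(k, j)`, `1 ≤ j ≤ n_k`, of a Hall basic sequence is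
an element of `Level w k`, where `w` is the (monotone) weight function on the single index set. -/
abbrev Level {N : ℕ} (w : Fin N → ℕ) (k : ℕ) : Type := {i : Fin N // w i = k}

/-- The ordered product `u ^ a = u₁ ^ a₁ * u₂ ^ a₂ * ⋯ * u_N ^ a_N` with integer exponents. -/
def orderedProd {G : Type*} [Group G] {N : ℕ} (u : Fin N → G) (a : Fin N → ℤ) : G :=
  (List.ofFn fun i => u i ^ a i).prod

/-- Extension by zero of a tuple indexed by the level `k` to a tuple with all `N` coordinates. -/
def extendLevel {A : Type*} [Zero A] {N : ℕ} (w : Fin N → ℕ) (k : ℕ) (v : Level w k → A) :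
    Fin N → A :=
  fun i => if h : w i = k then v ⟨i, h⟩ else 0

/-- `IsCommutatorOfWeight S n x`: the element `x` is a (possibly non-simple) commutator of weight `n`
in the elements of `S`, where `[x, y] = x⁻¹ y⁻¹ x y`. -/
inductive IsCommutatorOfWeight {G : Type*} [Group G] (S : Set G) : ℕ → G → Prop
  | base (x : G) (hx : x ∈ S) : IsCommutatorOfWeight S 1 x
  | comm (m n : ℕ) (x y : G) (hx : IsCommutatorOfWeight S m x) (hy : IsCommutatorOfWeight S n y) :
      IsCommutatorOfWeight S (m + n) (x⁻¹ * y⁻¹ * x * y)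

/-- `G` is free nilpotent of class `c` on the family `g`: the homomorphism from the free group
that sends the free generators to the `g k` is onto with kernel `Γ_{c+1}` of the free group.
(Mathlib numbers the lower central series from `0`, so `Γ_{k+1}` is `lowerCentralSeries ⊤ k`.) -/
structure IsFreeNilpotentOn {ι G : Type*} [Group G] (c : ℕ) (g : ι → G) : Prop where
  surjective : Function.Surjective (FreeGroup.lift g)
  ker_eq : (FreeGroup.lift g).ker = (⊤ : Subgroup (FreeGroup ι)).lowerCentralSeries c

/-- `u` is a Hall basic sequence, with weights `w`, of the free nilpotent group `G` of rank `r` and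
class `c`. -/
structure IsHallBasicSequence {G : Type*} [Group G] {N : ℕ} (r c : ℕ) (w : Fin N → ℕ)
    (u : Fin N → G) : Prop where
  weight_mono : Monotone w
  one_le_weight : ∀ i, 1 ≤ w i
  weight_le : ∀ i, w i ≤ c
  /-- There are `r` members of weight one, and they freely generate `G` as a nilpotent group. -/
  card_level_one : Fintype.card (Level w 1) = r
  free : IsFreeNilpotentOn c (fun k : Level w 1 => u k)
  /-- Each `u i` is a commutator of weight `w i` in the members of weight one. -/
  isCommutator : ∀ i, IsCommutatorOfWeight (Set.range fun k : Level w 1 => u k) (w i) (u i)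
  /-- The members of weight `k + 1` freely generate the abelian group `Γ_{k+1} / Γ_{k+2}`. -/
  basis : ∀ k < c, ∀ g ∈ (⊤ : Subgroup G).lowerCentralSeries k,
    ∃! e : Level w (k + 1) → ℤ,
      (orderedProd u (extendLevel w (k + 1) e))⁻¹ * g ∈
        (⊤ : Subgroup G).lowerCentralSeries (k + 1)

/-! ### Canonical polynomials -/

/-- Integer linear combinations of products of binomial coefficients `∏ s, binom(x_s, m_s)`,
that is, polynomials with rational coefficients written in the binomial basis. -/
abbrev HallPolynomial (σ : Type*) : Type _ := (σ →₀ ℕ) →₀ ℤ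

/-- The value of a Hall polynomial at a point of a binomial ring. -/
noncomputable def HallPolynomial.eval {σ R : Type*} [CommRing R] [BinomialRing R]
    (P : HallPolynomial σ) (x : σ → R) : R :=
  P.sum fun m z => (z : R) * m.prod fun s k => Ring.choose (x s) k

/-- `p` describes the multiplication in the coordinates given by `u`:
`u ^ a * u ^ b = u ^ p(a, b)` for all integer tuples `a`, `b`. -/
def DescribesProduct {G : Type*} [Group G] {N : ℕ} (u : Fin N → G)
    (p : Fin N → HallPolynomial (Fin N ⊕ Fin N)) : Prop :=
  ∀ a b : Fin N → ℤ,
    orderedProd u a * orderedProd u b = orderedProd u fun i => (p i).eval (Sum.elim a b)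

/-- `q` describes powers in the coordinates given by `u`:
`(u ^ a) ^ l = u ^ q(a, l)` for all integer tuples `a` and integers `l`. -/
def DescribesPower {G : Type*} [Group G] {N : ℕ} (u : Fin N → G)
    (q : Fin N → HallPolynomial (Fin N ⊕ Unit)) : Prop :=
  ∀ (a : Fin N → ℤ) (l : ℤ),
    orderedProd u a ^ l = orderedProd u fun i => (q i).eval (Sum.elim a fun _ => l)

/-- The canonical polynomials `p_i` of `u`. For a Hall basic sequence they are uniquely determined
by the property `DescribesProduct`. -/
noncomputable def canonicalProduct {G : Type*} [Group G] {N : ℕ} (u : Fin N → G) :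
    Fin N → HallPolynomial (Fin N ⊕ Fin N) :=
  Classical.epsilon (DescribesProduct u)

/-- The canonical polynomials `q_i` of `u`. For a Hall basic sequence they are uniquely determined
by the property `DescribesPower`. -/
noncomputable def canonicalPower {G : Type*} [Group G] {N : ℕ} (u : Fin N → G) :
    Fin N → HallPolynomial (Fin N ⊕ Unit) :=
  Classical.epsilon (DescribesPower u)

/-! ### The Hall completion and its deformations -/

section Coordinates

variable {G R : Type*} [Group G] [CommRing R] [BinomialRing R] {N : ℕ}

/-- The exponent tuple `p(a, b)` of the product `u ^ a * u ^ b` in the Hall `R`-completion. -/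
noncomputable def hallMul (u : Fin N → G) (a b : Fin N → R) : Fin N → R :=
  fun i => (canonicalProduct u i).eval (Sum.elim a b)

/-- The exponent tuple `q(a, -1)` of the inverse of `u ^ a` in the Hall `R`-completion. -/
noncomputable def hallInv (u : Fin N → G) (a : Fin N → R) : Fin N → R :=
  fun i => (canonicalPower u i).eval (Sum.elim a fun _ => -1)

/-- The tuple with coordinates `∑ k, f^k_j(a_{1k}, b_{1k})` at the indices `(c, j)` of weight `c`
and zero at all other indices. -/
def deformationTerm (w : Fin N → ℕ) (c : ℕ) (f : Level w 1 → R → R → Level w c → R)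
    (a b : Fin N → R) : Fin N → R :=
  extendLevel w c (∑ k : Level w 1, f k (a k) (b k))

/-- The exponent tuple of the deformed product of `u ^ a` and `u ^ b`. -/
noncomputable def deformedMul (u : Fin N → G) (w : Fin N → ℕ) (c : ℕ)
    (f : Level w 1 → R → R → Level w c → R) (a b : Fin N → R) : Fin N → R :=
  hallMul u a b + deformationTerm w c f a b

/-- The exponent tuple of the deformed inverse of `u ^ a`. -/
noncomputable def deformedInv (u : Fin N → G) (w : Fin N → ℕ) (c : ℕ)
    (f : Level w 1 → R → R → Level w c → R) (a : Fin N → R) : Fin N → R :=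
  hallInv u a - deformationTerm w c f a (-a)

/-- The tuple `a'` of the coordinates of weight less than `c` of `a`, followed by zeros. -/
def lowPart (w : Fin N → ℕ) (c : ℕ) (a : Fin N → R) : Fin N → R :=
  fun i => if w i < c then a i else 0

/-- The tuple that keeps the coordinates of weight `c` of `a` and has zeros elsewhere, so that
`u ^ topPart w c a` is `u_c ^ a_c`. -/
def topPart (w : Fin N → ℕ) (c : ℕ) (a : Fin N → R) : Fin N → R :=
  extendLevel w c fun i => a i

end Coordinates

/-- The underlying set of `N_{r,c}(R)`: formal products `u ^ a` with exponents `a` in `R`. -/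
@[ext]
structure HallCompletion {G : Type*} {N : ℕ} (u : Fin N → G) (R : Type*) where
  exponent : Fin N → R

/-- The underlying set of `N_{r,c}(R, f)`: formal products `u ^ a` with exponents `a` in `R`. -/
@[ext]
structure HallDeformation {G R : Type*} {N : ℕ} (u : Fin N → G) (w : Fin N → ℕ) (c : ℕ)
    (f : Level w 1 → R → R → Level w c → R) where
  exponent : Fin N → R

/-! ### Cocycles and central extensions -/

/-- A symmetric (normalized) `2`-cocycle between additively written abelian groups. -/
structure IsSymmTwoCocycle {B A : Type*} [AddCommGroup B] [AddCommGroup A] (f : B → B → A) :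
    Prop where
  cocycle : ∀ x y z, f (x + y) z + f x y = f x (y + z) + f y z
  zero_left : ∀ x, f 0 x = 0
  zero_right : ∀ x, f x 0 = 0
  symm : ∀ x y, f x y = f y x

/-- A (normalized) `2`-cocycle of a group `B` with values in an abelian group `A`, the action being
trivial. -/
structure CentralTwoCocycle (B A : Type*) [Group B] [CommGroup A] where
  toFun : B → B → A
  cocycle : ∀ x y z, toFun (x * y) z * toFun x y = toFun x (y * z) * toFun y z
  one_left : ∀ x, toFun 1 x = 1
  one_right : ∀ x, toFun x 1 = 1

/-- The underlying set `B × A` of the group `E(k)`. -/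
@[ext]
structure CocycleExtension {B A : Type*} [Group B] [CommGroup A] (k : CentralTwoCocycle B A) where
  base : B
  fiber : A

namespace CocycleExtension

variable {B A : Type*} [Group B] [CommGroup A] {k : CentralTwoCocycle B A}

/-- `(b₁, a₁) (b₂, a₂) = (b₁ b₂, a₁ a₂ k(b₁, b₂))`. -/
instance : Mul (CocycleExtension k) :=
  ⟨fun x y => ⟨x.base * y.base, x.fiber * y.fiber * k.toFun x.base y.base⟩⟩

instance : One (CocycleExtension k) := ⟨⟨1, 1⟩⟩

instance : Inv (CocycleExtension k) :=
  ⟨fun x => ⟨x.base⁻¹, x.fiber⁻¹ * (k.toFun x.base⁻¹ x.base)⁻¹⟩⟩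

@[simp] theorem base_mul (x y : CocycleExtension k) : (x * y).base = x.base * y.base := rfl

@[simp] theorem fiber_mul (x y : CocycleExtension k) :
    (x * y).fiber = x.fiber * y.fiber * k.toFun x.base y.base := rfl

@[simp] theorem base_one : (1 : CocycleExtension k).base = 1 := rfl

@[simp] theorem fiber_one : (1 : CocycleExtension k).fiber = 1 := rfl

@[simp] theorem base_inv (x : CocycleExtension k) : x⁻¹.base = x.base⁻¹ := rfl

@[simp] theorem fiber_inv (x : CocycleExtension k) :
    x⁻¹.fiber = x.fiber⁻¹ * (k.toFun x.base⁻¹ x.base)⁻¹ := rfl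

instance : Group (CocycleExtension k) :=
  Group.ofLeftAxioms
    (fun x y z => by
      ext
      · simp [mul_assoc]
      · have h := k.cocycle x.base y.base z.base
        simp only [fiber_mul, base_mul]
        calc x.fiber * y.fiber * k.toFun x.base y.base * z.fiber *
              k.toFun (x.base * y.base) z.base
            = x.fiber * y.fiber * z.fiber *
              (k.toFun (x.base * y.base) z.base * k.toFun x.base y.base) := by
              simp only [mul_assoc, mul_comm, mul_left_comm]
          _ = _ := by rw [h]; simp only [mul_assoc, mul_comm, mul_left_comm])
    (fun x => by ext <;> simp [k.one_left])
    (fun x => by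
      ext
      · simp
      · simp only [fiber_mul, fiber_inv, base_inv, fiber_one]
        simp [mul_comm])

end CocycleExtension

/-- The extension `1 → A → E(k) → B → 1` with the maps `a ↦ (1, a)` and `(b, a) ↦ b`. -/
def CentralTwoCocycle.extension {B A : Type*} [Group B] [CommGroup A]
    (k : CentralTwoCocycle B A) : GroupExtension A (CocycleExtension k) B where
  inl :=
    { toFun := fun a => ⟨1, a⟩
      map_one' := rfl
      map_mul' := fun x y => by ext <;> simp [k.one_left] }
  rightHom :=
    { toFun := fun x => x.base
      map_one' := rfl
      map_mul' := fun _ _ => rfl }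
  inl_injective := fun _ _ h => congrArg CocycleExtension.fiber h
  range_inl_eq_ker_rightHom := by
    ext x
    constructor
    · rintro ⟨a, rfl⟩
      rfl
    · intro h
      exact ⟨x.fiber, CocycleExtension.ext h.symm rfl⟩
  rightHom_surjective := fun b => ⟨⟨b, 1⟩, rfl⟩

-- makes the (commutative) centre of a group a `CommGroup`
open scoped IsMulCommutative

/-!
The formal product on exponent tuples over `R` is a group law because it is one over `ℤ`: each
group axiom, and each structural property used below, is an identity between polynomials with
rational coefficients that holds at all integer points, hence identically, hence at all points of
`R` (the values are compared in the field of fractions of `R`, a `ℚ`-algebra; see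
`SamePolynomialInt.eq_of_eq`). The content is therefore in the integral case, and in a description
of the centre that can be transferred in this way.

**Canonical polynomials.** Let `F` be the free group on the generators and send each generator `x`
to `1 + x t` in the power series over the free associative ring. Elements of `Γ_k` go to series
`1 + θ t ^ k + ⋯`, and `θ` is additive on `Γ_k / Γ_{k+1}` and takes commutators to Lie brackets. The
free associative ring also acts on the graded group `∏ Γ_k / Γ_{k+1}`, enlarged by an element `d`
that represents the derivation multiplying by the weight, so that `x` acts as `⁅x, ·⁆`; then `θ`
acts as the bracket with the element it comes from (`gradedAction_coeff_magnus`), and the value at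
`d` recovers `k` times that element. This is the Dynkin-Specht-Wever identity, and it shows that
`θ = 0` forces the class in `Γ_k / Γ_{k+1}` to be torsion (`pow_mem_of_coeff_magnus_eq_zero`). For
a Hall basic sequence that group is free abelian on the members of weight `k`, so their leading
coefficients `θ` are linearly independent (`IsHallBasicSequence.linearIndependent_leadingCoeff`).
Hence the exponents of an element are determined by its Magnus expansion, successively in the
weight, by rational linear formulas. The coefficients of the expansion of `u ^ a * u ^ b` and of
`(u ^ a) ^ l` are polynomials in the exponents by the binomial series, so the exponents of these
elements are integer-valued polynomials, and such polynomials are integer combinations of products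
of binomial coefficients (`exists_hallPolynomial_eval_eq`). This gives the existence of the
canonical polynomials (`IsHallBasicSequence.exists_describesProduct`,
`IsHallBasicSequence.exists_describesPower`).

**The centre.** The members of weight `c` are central, which is the identity
`p(a + z, b + z') = p(a, b) + z + z'` for `z`, `z'` supported in weight `c`
(`IsHallBasicSequence.hallMul_add_topPart`). Conversely, only scalars of the free associative ring
commute with two different letters, so the exponents of weight `k < c` of an element of `Γ_k` are
rational linear combinations of the exponents of its commutation with the generators
(`IsHallBasicSequence.exists_exponent_formula`). This is again a polynomial identity, and over `R`
it shows that a central element has no coordinates of weight less than `c`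
(`IsHallBasicSequence.eq_zero_of_commute`).

**The extension.** The deformation adds to the product a term in weight `c` that depends only on
the coordinates of weight one, on which both products are addition since `c ≥ 2`. So the group
axioms of the deformation reduce to the cocycle identities, its product agrees with the undeformed
one modulo weight `c`, and by symmetry of the cocycles its centre is the same set. Separating the
coordinates of weight `c` in the deformed product gives
`topPart (a * b) = topPart a + topPart b + k(a, b)`
(`IsHallBasicSequence.topPart_deformedMul`), from which the cocycle identity for `k` and
the isomorphism with `E(k)` are read off.
-/

open scoped commutatorElement

/-! ### The graded group of the lower central series -/

section LowerCentralSeries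

variable {F : Type*} [Group F]

/-- `[Γ_{i+1}, Γ_{j+1}] ≤ Γ_{i+j+2}`. -/
theorem commutator_lowerCentralSeries_le (i j : ℕ) :
    ⁅(⊤ : Subgroup F).lowerCentralSeries i, (⊤ : Subgroup F).lowerCentralSeries j⁆ ≤
      (⊤ : Subgroup F).lowerCentralSeries (i + j + 1) := by
  induction j generalizing i with
  | zero => exact le_rfl
  | succ j ih =>
    -- the three subgroups lemma in the quotient by the target
    set M := (⊤ : Subgroup F).lowerCentralSeries (i + (j + 1) + 1) with hM
    have key : ∀ A B C : Subgroup F, ⁅⁅A, B⁆, C⁆ ≤ M →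
        ⁅⁅A.map (QuotientGroup.mk' M), B.map (QuotientGroup.mk' M)⁆,
          C.map (QuotientGroup.mk' M)⁆ = ⊥ := by
      intro A B C h
      rw [← Subgroup.map_commutator, ← Subgroup.map_commutator, Subgroup.map_eq_bot_iff,
        QuotientGroup.ker_mk']
      exact h
    have h1 : ⁅⁅(⊤ : Subgroup F), (⊤ : Subgroup F).lowerCentralSeries i⁆,
        (⊤ : Subgroup F).lowerCentralSeries j⁆ ≤ M := by
      rw [Subgroup.commutator_comm ⊤]
      exact (ih (i + 1)).trans (le_of_eq (by rw [hM]; congr 1; omega))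
    have h2 : ⁅⁅(⊤ : Subgroup F).lowerCentralSeries i, (⊤ : Subgroup F).lowerCentralSeries j⁆,
        (⊤ : Subgroup F)⁆ ≤ M :=
      (Subgroup.commutator_mono (ih i) le_rfl).trans (le_of_eq (by
        rw [hM, ← Subgroup.lowerCentralSeries_succ]; congr 1))
    have h3 := Subgroup.commutator_commutator_eq_bot_of_rotate (key _ _ _ h1) (key _ _ _ h2)
    rw [← Subgroup.map_commutator, ← Subgroup.map_commutator, Subgroup.map_eq_bot_iff,
      QuotientGroup.ker_mk'] at h3
    rw [Subgroup.lowerCentralSeries_succ, Subgroup.commutator_comm]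
    exact h3

theorem commutator_mem_lowerCentralSeries {i j n : ℕ} {g h : F}
    (hg : g ∈ (⊤ : Subgroup F).lowerCentralSeries i)
    (hh : h ∈ (⊤ : Subgroup F).lowerCentralSeries j) (hn : n ≤ i + j + 1) :
    ⁅g, h⁆ ∈ (⊤ : Subgroup F).lowerCentralSeries n :=
  Subgroup.lowerCentralSeries_antitone _ hn
    (commutator_lowerCentralSeries_le i j (Subgroup.commutator_mem_commutator hg hh))

theorem commute_mk_lowerCentralSeries {i j n : ℕ} {g h : F}
    (hg : g ∈ (⊤ : Subgroup F).lowerCentralSeries i)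
    (hh : h ∈ (⊤ : Subgroup F).lowerCentralSeries j) (hn : n ≤ i + j + 1) :
    Commute (g : F ⧸ (⊤ : Subgroup F).lowerCentralSeries n) h := by
  have h1 := (QuotientGroup.eq_one_iff _).2 (commutator_mem_lowerCentralSeries hg hh hn)
  exact commutatorElement_eq_one_iff_commute.1
    ((map_commutatorElement (QuotientGroup.mk' _) g h).symm.trans h1)

/-- The bracket is additive in the second variable modulo terms of higher weight. -/
theorem mk_commutator_mul {k m : ℕ} {g p q : F}
    (hg : g ∈ (⊤ : Subgroup F).lowerCentralSeries k)
    (hp : p ∈ (⊤ : Subgroup F).lowerCentralSeries m) :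
    ((⁅g, p * q⁆ : F) : F ⧸ (⊤ : Subgroup F).lowerCentralSeries (k + m + 2)) =
      (⁅g, p⁆ : F) * (⁅g, q⁆ : F) := by
  have e : ⁅g, p * q⁆ = ⁅g, p⁆ * (p * ⁅g, q⁆ * p⁻¹) := by
    simp only [commutatorElement_def]; group
  have hc : Commute (p : F ⧸ (⊤ : Subgroup F).lowerCentralSeries (k + m + 2)) (⁅g, q⁆ : F) :=
    commute_mk_lowerCentralSeries hp
      (commutator_mem_lowerCentralSeries (j := 0) hg (Subgroup.mem_top q) le_rfl) (by omega)
  rw [e, QuotientGroup.mk_mul, QuotientGroup.mk_mul, QuotientGroup.mk_mul, QuotientGroup.mk_inv,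
    hc.eq, mul_inv_cancel_right]

/-- The bracket is additive in the first variable modulo terms of higher weight. -/
theorem mk_mul_commutator {k m : ℕ} {g h p : F}
    (hg : g ∈ (⊤ : Subgroup F).lowerCentralSeries k)
    (hp : p ∈ (⊤ : Subgroup F).lowerCentralSeries m) :
    ((⁅g * h, p⁆ : F) : F ⧸ (⊤ : Subgroup F).lowerCentralSeries (k + m + 2)) =
      (⁅g, p⁆ : F) * (⁅h, p⁆ : F) := by
  have h1 : ⁅g * h, p⁆ = ⁅p, g * h⁆⁻¹ := (commutatorElement_inv _ _).symm
  rw [h1]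
  have h2 := mk_commutator_mul (q := h) hp hg
  have h3 : m + k + 2 = k + m + 2 := by omega
  rw [h3] at h2
  have hc : Commute ((⁅g, p⁆ : F) : F ⧸ (⊤ : Subgroup F).lowerCentralSeries (k + m + 2))
      (⁅h, p⁆ : F) :=
    commute_mk_lowerCentralSeries (i := k + m + 1) (j := m + 1)
      (commutator_mem_lowerCentralSeries hg hp le_rfl)
      (commutator_mem_lowerCentralSeries (i := 0) (Subgroup.mem_top h) hp (by omega)) (by omega)
  rw [QuotientGroup.mk_inv, h2, mul_inv_rev, ← QuotientGroup.mk_inv, ← QuotientGroup.mk_inv,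
    commutatorElement_inv, commutatorElement_inv, hc.eq]

/-- The Jacobi identity modulo terms of higher weight. -/
theorem mk_commutator_commutator {i j m : ℕ} {g h p : F}
    (hg : g ∈ (⊤ : Subgroup F).lowerCentralSeries i)
    (hh : h ∈ (⊤ : Subgroup F).lowerCentralSeries j)
    (hp : p ∈ (⊤ : Subgroup F).lowerCentralSeries m) :
    ((⁅⁅g, h⁆, p⁆ : F) : F ⧸ (⊤ : Subgroup F).lowerCentralSeries (i + j + m + 3)) =
      ((⁅g, ⁅h, p⁆⁆ * ⁅h, ⁅g, p⁆⁆⁻¹ : F) : F ⧸ _) := by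
  have hgh := commutator_mem_lowerCentralSeries hg hh le_rfl
  have hhp := commutator_mem_lowerCentralSeries hh hp le_rfl
  have hgp := commutator_mem_lowerCentralSeries hg hp le_rfl
  -- both sides of `g h = ⁅g, h⁆ h g` are expanded in their action on `p`
  have e : ⁅g, ⁅h, p⁆⁆ * ⁅h, p⁆ * ⁅g, p⁆ =
      ⁅⁅g, h⁆, ⁅h * g, p⁆⁆ * (⁅h, ⁅g, p⁆⁆ * ⁅g, p⁆ * ⁅h, p⁆) * ⁅⁅g, h⁆, p⁆ := by
    simp only [commutatorElement_def]; group
  have hdeep : ((⁅⁅g, h⁆, ⁅h * g, p⁆⁆ : F) :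
      F ⧸ (⊤ : Subgroup F).lowerCentralSeries (i + j + m + 3)) = 1 :=
    (QuotientGroup.eq_one_iff _).2 (commutator_mem_lowerCentralSeries hgh
      (commutator_mem_lowerCentralSeries (i := 0) (Subgroup.mem_top _) hp le_rfl) (by omega))
  have hc := commute_mk_lowerCentralSeries (n := i + j + m + 3) hgp hhp (by omega)
  have hd : ∀ q : F, Commute ((⁅⁅g, h⁆, p⁆ : F) :
      F ⧸ (⊤ : Subgroup F).lowerCentralSeries (i + j + m + 3)) q := fun q =>
    commute_mk_lowerCentralSeries (i := i + j + m + 2) (j := 0)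
      (commutator_mem_lowerCentralSeries hgh hp (by omega)) (Subgroup.mem_top q) (by omega)
  have e' := congrArg (fun x : F => (x : F ⧸ (⊤ : Subgroup F).lowerCentralSeries (i + j + m + 3))) e
  simp only [QuotientGroup.mk_mul, hdeep, one_mul] at e'
  have hd' := hd (⁅h, ⁅g, p⁆⁆ * ⁅g, p⁆ * ⁅h, p⁆)
  simp only [QuotientGroup.mk_mul] at hd'
  rw [mul_assoc, ← hc.eq, ← hd'.eq, ← mul_assoc, ← mul_assoc, ← mul_assoc] at e'
  rw [QuotientGroup.mk_mul, QuotientGroup.mk_inv,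
    mul_right_cancel (mul_right_cancel e'), mul_inv_cancel_right]

variable (F) in
/-- Sequences of elements `p n ∈ Γ_{n+1}`. -/
def LowerSeq : Subgroup (ℕ → F) where
  carrier := {p | ∀ n, p n ∈ (⊤ : Subgroup F).lowerCentralSeries n}
  mul_mem' hp hq n := mul_mem (hp n) (hq n)
  one_mem' _ := one_mem _
  inv_mem' hp n := inv_mem (hp n)

variable (F) in
/-- Sequences of elements `p n ∈ Γ_{n+2}`. -/
def LowerSeqSucc : Subgroup (LowerSeq F) where
  carrier := {p | ∀ n, p.1 n ∈ (⊤ : Subgroup F).lowerCentralSeries (n + 1)}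
  mul_mem' hp hq n := mul_mem (hp n) (hq n)
  one_mem' _ := one_mem _
  inv_mem' hp n := inv_mem (hp n)

instance : (LowerSeqSucc F).Normal :=
  ⟨fun _ hp q n => Subgroup.Normal.conj_mem inferInstance _ (hp n) (q.1 n)⟩

variable (F) in
/-- The product of the abelian groups `Γ_{n+1} / Γ_{n+2}` over all `n`, written additively.
Sequences of group elements are used in place of a family of quotients, so that the bracket, which
shifts degrees, involves no dependent types. -/
abbrev GradedLCS : Type _ := Additive (LowerSeq F ⧸ LowerSeqSucc F)

/-- The class of a sequence. -/
def GradedLCS.mk (p : LowerSeq F) : GradedLCS F := Additive.ofMul (QuotientGroup.mk p)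

theorem GradedLCS.mk_eq_mk {p q : LowerSeq F} :
    GradedLCS.mk p = GradedLCS.mk q ↔
      ∀ n, (p.1 n : F ⧸ (⊤ : Subgroup F).lowerCentralSeries (n + 1)) = q.1 n := by
  unfold GradedLCS.mk
  rw [Additive.ofMul.injective.eq_iff, QuotientGroup.eq]
  exact forall_congr' fun n => QuotientGroup.eq.symm

theorem GradedLCS.mk_mul (p q : LowerSeq F) :
    GradedLCS.mk (p * q) = GradedLCS.mk p + GradedLCS.mk q := rfl

theorem GradedLCS.mk_surjective : Function.Surjective (GradedLCS.mk (F := F)) :=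
  QuotientGroup.mk_surjective

instance : AddCommGroup (GradedLCS F) where
  add_comm x y := by
    obtain ⟨p, rfl⟩ := GradedLCS.mk_surjective x
    obtain ⟨q, rfl⟩ := GradedLCS.mk_surjective y
    rw [← GradedLCS.mk_mul, ← GradedLCS.mk_mul, GradedLCS.mk_eq_mk]
    exact fun n => (commute_mk_lowerCentralSeries (p.2 n) (q.2 n) (by omega)).eq

/-- The sequence with the entry `g` at `k` and `1` elsewhere. -/
def LowerSeq.single (k : ℕ) (g : F) (hg : g ∈ (⊤ : Subgroup F).lowerCentralSeries k) :
    LowerSeq F :=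
  ⟨fun n => if n = k then g else 1, fun n => by
    by_cases h : n = k
    · subst h; simpa using hg
    · simp [h]⟩

/-- The sequence of the brackets `⁅g, p n⁆`, shifted by the weight `k + 1` of `g`. -/
def LowerSeq.bracket (k : ℕ) (g : F) (hg : g ∈ (⊤ : Subgroup F).lowerCentralSeries k)
    (p : LowerSeq F) : LowerSeq F :=
  ⟨fun n => if k < n then ⁅g, p.1 (n - k - 1)⁆ else 1, fun n => by
    by_cases h : k < n
    · simpa only [h, if_true] using
        commutator_mem_lowerCentralSeries hg (p.2 (n - k - 1)) (by omega)
    · simp [h]⟩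

/-- The operator `⁅g, ·⁆` on the graded group. -/
def GradedLCS.ad (k : ℕ) (g : F) (hg : g ∈ (⊤ : Subgroup F).lowerCentralSeries k) :
    AddMonoid.End (GradedLCS F) :=
  MonoidHom.toAdditive (QuotientGroup.lift (LowerSeqSucc F)
    (MonoidHom.mk' (fun p => (QuotientGroup.mk (LowerSeq.bracket k g hg p) :
      LowerSeq F ⧸ LowerSeqSucc F)) (fun p q => by
      refine Additive.ofMul.injective (GradedLCS.mk_eq_mk.2 fun n => ?_)
      simp only [LowerSeq.bracket, Subgroup.coe_mul, Pi.mul_apply]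
      by_cases h : k < n
      · obtain ⟨m, rfl⟩ : ∃ m, n = k + m + 1 := ⟨n - k - 1, by omega⟩
        have e : k + m + 1 - k - 1 = m := by omega
        simp only [h, if_true, e]
        exact mk_commutator_mul hg (p.2 m)
      · simp [h]))
    (fun p hp => by
      refine Additive.ofMul.injective (GradedLCS.mk_eq_mk (q := 1).2 fun n => ?_)
      simp only [LowerSeq.bracket]
      by_cases h : k < n
      · simp only [h, if_true]
        exact (QuotientGroup.eq_one_iff _).2
          (commutator_mem_lowerCentralSeries hg (hp (n - k - 1)) (by omega))
      · simp [h]))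

theorem GradedLCS.ad_mk (k : ℕ) (g : F) (hg : g ∈ (⊤ : Subgroup F).lowerCentralSeries k)
    (p : LowerSeq F) : GradedLCS.ad k g hg (.mk p) = .mk (LowerSeq.bracket k g hg p) := rfl

theorem GradedLCS.mk_single_mul (k : ℕ) (g h : F)
    (hg : g ∈ (⊤ : Subgroup F).lowerCentralSeries k)
    (hh : h ∈ (⊤ : Subgroup F).lowerCentralSeries k) :
    GradedLCS.mk (LowerSeq.single k (g * h) (mul_mem hg hh)) =
      .mk (LowerSeq.single k g hg) + .mk (LowerSeq.single k h hh) := by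
  rw [← GradedLCS.mk_mul, GradedLCS.mk_eq_mk]
  intro n
  by_cases e : n = k <;> simp [LowerSeq.single, e]

theorem GradedLCS.ad_mul (k : ℕ) (g h : F)
    (hg : g ∈ (⊤ : Subgroup F).lowerCentralSeries k)
    (hh : h ∈ (⊤ : Subgroup F).lowerCentralSeries k) :
    GradedLCS.ad k (g * h) (mul_mem hg hh) = GradedLCS.ad k g hg + GradedLCS.ad k h hh := by
  refine DFunLike.ext _ _ fun x => ?_
  obtain ⟨p, rfl⟩ := GradedLCS.mk_surjective x
  refine (GradedLCS.mk_eq_mk (q := LowerSeq.bracket k g hg p * LowerSeq.bracket k h hh p)).2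
    fun n => ?_
  simp only [LowerSeq.bracket, Subgroup.coe_mul, Pi.mul_apply]
  by_cases h : k < n
  · obtain ⟨m, rfl⟩ : ∃ m, n = k + m + 1 := ⟨n - k - 1, by omega⟩
    have e : k + m + 1 - k - 1 = m := by omega
    simp only [h, if_true, e]
    exact mk_mul_commutator hg (p.2 m)
  · simp [h]

theorem GradedLCS.ad_single (i j : ℕ) (g h : F)
    (hg : g ∈ (⊤ : Subgroup F).lowerCentralSeries i)
    (hh : h ∈ (⊤ : Subgroup F).lowerCentralSeries j) :
    GradedLCS.ad i g hg (.mk (LowerSeq.single j h hh)) =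
      .mk (LowerSeq.single (i + j + 1) ⁅g, h⁆
        (commutator_mem_lowerCentralSeries hg hh le_rfl)) := by
  rw [GradedLCS.ad_mk, GradedLCS.mk_eq_mk]
  intro n
  simp only [LowerSeq.bracket, LowerSeq.single]
  by_cases e : n = i + j + 1
  · subst e
    have e1 : i < i + j + 1 := by omega
    have e2 : i + j + 1 - i - 1 = j := by omega
    simp [e1, e2]
  · by_cases e1 : i < n
    · have e2 : n - i - 1 ≠ j := by omega
      simp [e, e2]
    · simp [e, e1]

theorem GradedLCS.mk_single_commutator_swap (i j : ℕ) (g h : F)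
    (hg : g ∈ (⊤ : Subgroup F).lowerCentralSeries i)
    (hh : h ∈ (⊤ : Subgroup F).lowerCentralSeries j) :
    GradedLCS.mk (LowerSeq.single (j + i + 1) ⁅h, g⁆
        (commutator_mem_lowerCentralSeries hh hg le_rfl)) =
      - GradedLCS.mk (LowerSeq.single (i + j + 1) ⁅g, h⁆
        (commutator_mem_lowerCentralSeries hg hh le_rfl)) := by
  rw [eq_neg_iff_add_eq_zero, ← GradedLCS.mk_mul]
  refine (GradedLCS.mk_eq_mk (q := 1)).2 fun n => ?_
  have e : j + i + 1 = i + j + 1 := by omega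
  by_cases hn : n = i + j + 1
  · simp only [LowerSeq.single, e, hn, Subgroup.coe_mul, Pi.mul_apply, if_true]
    rw [← commutatorElement_inv g h, inv_mul_cancel]
    rfl
  · simp [LowerSeq.single, e, hn]

theorem GradedLCS.ad_commutator (i j : ℕ) (g h : F)
    (hg : g ∈ (⊤ : Subgroup F).lowerCentralSeries i)
    (hh : h ∈ (⊤ : Subgroup F).lowerCentralSeries j) (x : GradedLCS F) :
    GradedLCS.ad (i + j + 1) ⁅g, h⁆ (commutator_mem_lowerCentralSeries hg hh le_rfl) x =
      GradedLCS.ad i g hg (GradedLCS.ad j h hh x) -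
        GradedLCS.ad j h hh (GradedLCS.ad i g hg x) := by
  obtain ⟨p, rfl⟩ := GradedLCS.mk_surjective x
  simp only [GradedLCS.ad_mk]
  rw [sub_eq_add_neg]
  refine (GradedLCS.mk_eq_mk (q := _ * (_)⁻¹)).2 fun n => ?_
  simp only [LowerSeq.bracket, Subgroup.coe_mul, Pi.mul_apply, Subgroup.coe_inv, Pi.inv_apply]
  by_cases h1 : i + j + 1 < n
  · obtain ⟨m, rfl⟩ : ∃ m, n = i + j + m + 2 := ⟨n - i - j - 2, by omega⟩
    have a1 : i < i + j + m + 2 := by omega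
    have a2 : j < i + j + m + 2 := by omega
    have a3 : j < i + j + m + 2 - i - 1 := by omega
    have a4 : i < i + j + m + 2 - j - 1 := by omega
    have a5 : i + j + m + 2 - (i + j + 1) - 1 = m := by omega
    have a6 : i + j + m + 2 - i - 1 - j - 1 = m := by omega
    have a7 : i + j + m + 2 - j - 1 - i - 1 = m := by omega
    simp only [h1, a1, a2, a3, a4, a5, a6, a7, if_true]
    exact mk_commutator_commutator hg hh (p.2 m)
  · have a3 : ¬ (j < n - i - 1) := by omega
    have a4 : ¬ (i < n - j - 1) := by omega
    simp [h1, a3, a4]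

/-- The bracket with an element `g` of weight `k + 1` on the graded group, extended by a basis
element `d` of an infinite cyclic group on which it takes the value `(k + 1) g`. In other words,
the graded Lie ring is extended by the derivation that multiplies by the weight. -/
def GradedLCS.adExt (k : ℕ) (g : F) (hg : g ∈ (⊤ : Subgroup F).lowerCentralSeries k) :
    AddMonoid.End (GradedLCS F × ℤ) :=
  ((GradedLCS.ad k g hg).coprod
    (zmultiplesHom _ ((k + 1) • GradedLCS.mk (LowerSeq.single k g hg)))).prod 0

theorem GradedLCS.adExt_apply (k : ℕ) (g : F) (hg : g ∈ (⊤ : Subgroup F).lowerCentralSeries k)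
    (x : GradedLCS F × ℤ) :
    GradedLCS.adExt k g hg x =
      (GradedLCS.ad k g hg x.1 + x.2 • (k + 1) • GradedLCS.mk (LowerSeq.single k g hg), 0) := rfl

theorem GradedLCS.adExt_mul (k : ℕ) (g h : F)
    (hg : g ∈ (⊤ : Subgroup F).lowerCentralSeries k)
    (hh : h ∈ (⊤ : Subgroup F).lowerCentralSeries k) :
    GradedLCS.adExt k (g * h) (mul_mem hg hh) =
      GradedLCS.adExt k g hg + GradedLCS.adExt k h hh := by
  refine DFunLike.ext _ _ fun x => ?_
  change _ = GradedLCS.adExt k g hg x + GradedLCS.adExt k h hh x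
  simp only [GradedLCS.adExt_apply, GradedLCS.ad_mul k g h hg hh,
    GradedLCS.mk_single_mul k g h hg hh, Prod.mk_add_mk, smul_add, add_zero]
  change (GradedLCS.ad k g hg x.1 + GradedLCS.ad k h hh x.1 + _, _) = _
  congr 1
  abel

/-- The extended bracket is a representation: at `d` this is the identity
`(i + j + 2) ⁅g, h⁆ = (j + 1) ⁅g, h⁆ - (i + 1) ⁅h, g⁆`. -/
theorem GradedLCS.adExt_commutator (i j : ℕ) (g h : F)
    (hg : g ∈ (⊤ : Subgroup F).lowerCentralSeries i)
    (hh : h ∈ (⊤ : Subgroup F).lowerCentralSeries j) :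
    GradedLCS.adExt (i + j + 1) ⁅g, h⁆ (commutator_mem_lowerCentralSeries hg hh le_rfl) =
      GradedLCS.adExt i g hg * GradedLCS.adExt j h hh -
        GradedLCS.adExt j h hh * GradedLCS.adExt i g hg := by
  refine DFunLike.ext _ _ fun x => ?_
  change _ = GradedLCS.adExt i g hg (GradedLCS.adExt j h hh x) -
    GradedLCS.adExt j h hh (GradedLCS.adExt i g hg x)
  simp only [GradedLCS.adExt_apply, GradedLCS.ad_commutator i j g h hg hh, map_add, map_zsmul,
    map_nsmul, GradedLCS.ad_single, Prod.mk_sub_mk, zero_smul, add_zero, sub_zero,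
    GradedLCS.mk_single_commutator_swap i j g h hg hh]
  congr 1
  have e : i + j + 1 + 1 = (i + 1) + (j + 1) := by omega
  rw [e, add_smul]
  simp only [smul_add, smul_neg]
  abel

/-- Evaluation at `d` shows that an element with zero extended bracket is a torsion element. -/
theorem GradedLCS.pow_mem_of_adExt_eq_zero (k : ℕ) (g : F)
    (hg : g ∈ (⊤ : Subgroup F).lowerCentralSeries k) (h : GradedLCS.adExt k g hg = 0) :
    g ^ (k + 1) ∈ (⊤ : Subgroup F).lowerCentralSeries (k + 1) := by
  have h1 : (k + 1) • GradedLCS.mk (LowerSeq.single k g hg) = 0 := by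
    have h2 := congrArg Prod.fst (DFunLike.congr_fun h (0, 1))
    rw [GradedLCS.adExt_apply] at h2
    simpa using h2
  have h3 : GradedLCS.mk ((LowerSeq.single k g hg) ^ (k + 1)) = GradedLCS.mk 1 := h1
  have h4 := GradedLCS.mk_eq_mk.1 h3 k
  have h5 : ((LowerSeq.single k g hg) ^ (k + 1)).1 k = g ^ (k + 1) := by
    simp [LowerSeq.single]
  rw [h5] at h4
  exact (QuotientGroup.eq_one_iff _).1 h4

end LowerCentralSeries

/-! ### Units of power series rings over noncommutative rings -/

section PowerSeriesUnits

open PowerSeries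

variable {B : Type*} [Ring B]

theorem PowerSeries.coeff_mul_of_vanish {m n : ℕ} {a b : PowerSeries B}
    (ha : ∀ i < m, coeff i a = 0) (hb : ∀ j < n, coeff j b = 0) :
    (∀ k < m + n, coeff k (a * b) = 0) ∧ coeff (m + n) (a * b) = coeff m a * coeff n b := by
  constructor
  · intro k hk
    rw [coeff_mul]
    refine Finset.sum_eq_zero fun x hx => ?_
    rw [Finset.HasAntidiagonal.mem_antidiagonal] at hx
    by_cases h : x.1 < m
    · rw [ha _ h, zero_mul]
    · rw [hb _ (by omega), mul_zero]
  · rw [coeff_mul, Finset.sum_eq_single (m, n)]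
    · intro x hx hne
      rw [Finset.HasAntidiagonal.mem_antidiagonal] at hx
      by_cases h : x.1 < m
      · rw [ha _ h, zero_mul]
      · have : x.2 < n := by
          by_contra h'
          exact hne (Prod.ext (by omega) (by omega))
        rw [hb _ this, mul_zero]
    · intro h
      exact absurd (by simp) h

/-- Congruence of power series modulo `X ^ (n + 1)`. -/
def EqUpTo (n : ℕ) (a b : PowerSeries B) : Prop := ∀ k ≤ n, coeff k a = coeff k b

namespace EqUpTo

variable {n : ℕ} {a b a' b' : PowerSeries B}

theorem symm (h : EqUpTo n a b) : EqUpTo n b a := fun k hk => (h k hk).symm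

theorem trans {d : PowerSeries B} (h : EqUpTo n a b) (h' : EqUpTo n b d) : EqUpTo n a d :=
  fun k hk => (h k hk).trans (h' k hk)

theorem mono {m : ℕ} (h : EqUpTo n a b) (hm : m ≤ n) : EqUpTo m a b :=
  fun k hk => h k (hk.trans hm)

theorem mul (h : EqUpTo n a b) (h' : EqUpTo n a' b') : EqUpTo n (a * a') (b * b') := by
  intro k hk
  rw [coeff_mul, coeff_mul]
  refine Finset.sum_congr rfl fun x hx => ?_
  rw [Finset.HasAntidiagonal.mem_antidiagonal] at hx
  rw [h _ (by omega), h' _ (by omega)]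

theorem refl (n : ℕ) (a : PowerSeries B) : EqUpTo n a a := fun _ _ => rfl

end EqUpTo

variable (B) in
/-- The units that are congruent to `1` modulo `X ^ (n + 1)`. -/
def unitsOneMod (n : ℕ) : Subgroup (PowerSeries B)ˣ where
  carrier := {u | EqUpTo n (u : PowerSeries B) 1}
  mul_mem' {u v} hu hv := by
    have := EqUpTo.mul (n := n) hu hv
    rwa [one_mul] at this
  one_mem' := EqUpTo.refl n 1
  inv_mem' {u} hu := by
    have := EqUpTo.mul (EqUpTo.refl n ((u⁻¹ : (PowerSeries B)ˣ) : PowerSeries B)) hu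
    rw [mul_one, ← Units.val_mul, inv_mul_cancel] at this
    exact this.symm

theorem coeff_sub_one_of_mem {n : ℕ} {u : (PowerSeries B)ˣ} (hu : u ∈ unitsOneMod B n) :
    ∀ i < n + 1, coeff i ((u : PowerSeries B) - 1) = 0 := fun i hi => by
  rw [map_sub, hu i (by omega), sub_self]

theorem coeff_succ_mul_of_mem {n : ℕ} {u v : (PowerSeries B)ˣ} (hu : u ∈ unitsOneMod B n)
    (hv : v ∈ unitsOneMod B n) :
    coeff (n + 1) ((u * v : (PowerSeries B)ˣ) : PowerSeries B) =
      coeff (n + 1) (u : PowerSeries B) + coeff (n + 1) (v : PowerSeries B) := by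
  have e : ((u * v : (PowerSeries B)ˣ) : PowerSeries B) =
      ((u : PowerSeries B) - 1) * (v - 1) + u + v - 1 := by
    rw [Units.val_mul]; noncomm_ring
  have h := (coeff_mul_of_vanish (coeff_sub_one_of_mem hu) (coeff_sub_one_of_mem hv)).1
    (n + 1) (by omega)
  rw [e, map_sub, map_add, map_add, h, coeff_one, if_neg (by omega), zero_add, sub_zero]

theorem commutator_mem_unitsOneMod {i j : ℕ} {u v : (PowerSeries B)ˣ} (hu : u ∈ unitsOneMod B i)
    (hv : v ∈ unitsOneMod B j) :
    ⁅u, v⁆ ∈ unitsOneMod B (i + j + 1) ∧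
      coeff (i + j + 2) ((⁅u, v⁆ : (PowerSeries B)ˣ) : PowerSeries B) =
        coeff (i + 1) (u : PowerSeries B) * coeff (j + 1) (v : PowerSeries B) -
          coeff (j + 1) (v : PowerSeries B) * coeff (i + 1) (u : PowerSeries B) := by
  have e : ((⁅u, v⁆ : (PowerSeries B)ˣ) : PowerSeries B) =
      1 + (((u : PowerSeries B) - 1) * (v - 1) - ((v : PowerSeries B) - 1) * (u - 1)) *
        ((u⁻¹ * v⁻¹ : (PowerSeries B)ˣ) : PowerSeries B) := by
    have e1 : ((u : PowerSeries B) - 1) * (v - 1) - ((v : PowerSeries B) - 1) * (u - 1) =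
        ((u * v : (PowerSeries B)ˣ) : PowerSeries B) -
          ((v * u : (PowerSeries B)ˣ) : PowerSeries B) := by
      rw [Units.val_mul, Units.val_mul]; noncomm_ring
    rw [e1, sub_mul, ← Units.val_mul, ← Units.val_mul, commutatorElement_def]
    have e2 : v * u * (u⁻¹ * v⁻¹) = 1 := by group
    rw [e2, Units.val_one, ← mul_assoc]
    noncomm_ring
  set w : (PowerSeries B)ˣ := u⁻¹ * v⁻¹
  have hw0 : coeff 0 (w : PowerSeries B) = 1 := by
    have : w ∈ unitsOneMod B 0 := mul_mem
      (inv_mem (EqUpTo.mono hu (Nat.zero_le _))) (inv_mem (EqUpTo.mono hv (Nat.zero_le _)))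
    simpa using this 0 le_rfl
  have h1 := coeff_mul_of_vanish (coeff_sub_one_of_mem hu) (coeff_sub_one_of_mem hv)
  have h2 := coeff_mul_of_vanish (coeff_sub_one_of_mem hv) (coeff_sub_one_of_mem hu)
  have ei : i + 1 + (j + 1) = i + j + 2 := by omega
  have ej : j + 1 + (i + 1) = i + j + 2 := by omega
  rw [ei] at h1
  rw [ej] at h2
  have h3 := coeff_mul_of_vanish (m := i + j + 2) (n := 0)
    (a := ((u : PowerSeries B) - 1) * ((v : PowerSeries B) - 1) -
      ((v : PowerSeries B) - 1) * ((u : PowerSeries B) - 1))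
    (b := (w : PowerSeries B))
    (fun k hk => by rw [map_sub, h1.1 k hk, h2.1 k hk, sub_self]) (by simp)
  constructor
  · intro k hk
    rw [e, map_add, h3.1 k (by omega), add_zero]
  · have h4 := h3.2
    rw [add_zero, map_sub, h1.2, h2.2, hw0, mul_one] at h4
    rw [e, map_add, h4]
    simp [coeff_one]

end PowerSeriesUnits

/-! ### The Magnus embedding -/

section Magnus

open PowerSeries

variable (X : Type*)

/-- The free associative ring on `X`. -/
abbrev FreeAssocRing : Type _ := MonoidAlgebra ℤ (FreeMonoid X)

variable {X}

/-- A free generator of the free associative ring. -/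
noncomputable def FreeAssocRing.letter (x : X) : FreeAssocRing X :=
  MonoidAlgebra.single (FreeMonoid.of x) 1

theorem isUnit_one_add_X_mul_C {B : Type*} [Ring B] (b : B) :
    IsUnit (1 + PowerSeries.X * C b : PowerSeries B) := by
  rw [isUnit_iff_constantCoeff]
  simp

/-- The Magnus homomorphism `x ↦ 1 + x t` from the free group to the units of the ring of formal
power series in `t` over the free associative ring. The variable `t` records the degree. -/
noncomputable def magnus : FreeGroup X →* (PowerSeries (FreeAssocRing X))ˣ :=
  FreeGroup.lift fun x => (isUnit_one_add_X_mul_C (FreeAssocRing.letter x)).unit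

theorem magnus_of (x : X) :
    (magnus (FreeGroup.of x) : PowerSeries (FreeAssocRing X)) =
      1 + PowerSeries.X * C (FreeAssocRing.letter x) := by
  simp [magnus]

theorem magnus_mem_unitsOneMod_zero (g : FreeGroup X) :
    magnus g ∈ unitsOneMod (FreeAssocRing X) 0 := by
  induction g using FreeGroup.induction_on with
  | C1 => rw [map_one]; exact one_mem _
  | of x =>
    intro k hk
    obtain rfl : k = 0 := by omega
    rw [magnus_of]
    simp
  | inv_of x h => rw [map_inv]; exact inv_mem h
  | mul g h hg hh => rw [map_mul]; exact mul_mem hg hh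

theorem magnus_mem_unitsOneMod (k : ℕ) {g : FreeGroup X}
    (hg : g ∈ (⊤ : Subgroup (FreeGroup X)).lowerCentralSeries k) :
    magnus g ∈ unitsOneMod (FreeAssocRing X) k := by
  suffices h : (⊤ : Subgroup (FreeGroup X)).lowerCentralSeries k ≤
      (unitsOneMod (FreeAssocRing X) k).comap magnus from h hg
  clear hg
  induction k with
  | zero => exact fun g _ => magnus_mem_unitsOneMod_zero g
  | succ k ih =>
    rw [Subgroup.lowerCentralSeries_succ, Subgroup.commutator_le]
    intro g hg h _
    rw [Subgroup.mem_comap, map_commutatorElement]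
    exact (commutator_mem_unitsOneMod (ih hg) (magnus_mem_unitsOneMod_zero h)).1

/-- The action of the free associative ring on the extended graded group of the free group in which
each generator acts as its bracket. -/
noncomputable def gradedAction :
    FreeAssocRing X →ₐ[ℤ] AddMonoid.End (GradedLCS (FreeGroup X) × ℤ) :=
  MonoidAlgebra.lift ℤ _ (FreeMonoid X)
    (FreeMonoid.lift fun x => GradedLCS.adExt 0 (FreeGroup.of x) (Subgroup.mem_top _))

theorem gradedAction_letter (x : X) : gradedAction (FreeAssocRing.letter x) =
    GradedLCS.adExt 0 (FreeGroup.of x) (Subgroup.mem_top _) := by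
  rw [gradedAction, FreeAssocRing.letter, MonoidAlgebra.lift_single]
  simp

theorem GradedLCS.adExt_one {F : Type*} [Group F] (k : ℕ) :
    GradedLCS.adExt k (1 : F) (one_mem _) = 0 := by
  have h := GradedLCS.adExt_mul k (1 : F) 1 (one_mem _) (one_mem _)
  simp only [mul_one] at h
  exact left_eq_add.1 h

theorem GradedLCS.adExt_inv {F : Type*} [Group F] (k : ℕ) (g : F)
    (hg : g ∈ (⊤ : Subgroup F).lowerCentralSeries k) :
    GradedLCS.adExt k g⁻¹ (inv_mem hg) = - GradedLCS.adExt k g hg := by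
  have h := GradedLCS.adExt_mul k g⁻¹ g (inv_mem hg) hg
  simp only [inv_mul_cancel, GradedLCS.adExt_one] at h
  exact eq_neg_of_add_eq_zero_left h.symm

theorem coeff_magnus_one (k : ℕ) :
    coeff (k + 1) ((magnus (1 : FreeGroup X) : (PowerSeries (FreeAssocRing X))ˣ) :
      PowerSeries (FreeAssocRing X)) = 0 := by
  rw [map_one, Units.val_one, coeff_one, if_neg (by omega)]

theorem coeff_magnus_mul (k : ℕ) {g h : FreeGroup X}
    (hg : g ∈ (⊤ : Subgroup (FreeGroup X)).lowerCentralSeries k)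
    (hh : h ∈ (⊤ : Subgroup (FreeGroup X)).lowerCentralSeries k) :
    coeff (k + 1) (magnus (g * h) : PowerSeries (FreeAssocRing X)) =
      coeff (k + 1) (magnus g : PowerSeries (FreeAssocRing X)) +
        coeff (k + 1) (magnus h : PowerSeries (FreeAssocRing X)) := by
  rw [map_mul]
  exact coeff_succ_mul_of_mem (magnus_mem_unitsOneMod k hg) (magnus_mem_unitsOneMod k hh)

theorem coeff_magnus_inv (k : ℕ) {g : FreeGroup X}
    (hg : g ∈ (⊤ : Subgroup (FreeGroup X)).lowerCentralSeries k) :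
    coeff (k + 1) (magnus g⁻¹ : PowerSeries (FreeAssocRing X)) =
      - coeff (k + 1) (magnus g : PowerSeries (FreeAssocRing X)) := by
  have h := coeff_magnus_mul k (inv_mem hg) hg
  rw [inv_mul_cancel, coeff_magnus_one] at h
  exact eq_neg_of_add_eq_zero_left h.symm

theorem mem_lowerCentralSeries_zero {F : Type*} [Group F] (g : F) :
    g ∈ (⊤ : Subgroup F).lowerCentralSeries 0 := Subgroup.mem_top g

theorem gradedAction_coeff_magnus_zero (g : FreeGroup X) :
    gradedAction (coeff 1 (magnus g : PowerSeries (FreeAssocRing X))) =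
      GradedLCS.adExt 0 g (mem_lowerCentralSeries_zero g) := by
  induction g using FreeGroup.induction_on with
  | C1 => rw [coeff_magnus_one, map_zero, GradedLCS.adExt_one]
  | of x =>
    rw [magnus_of, ← gradedAction_letter]
    congr 1
    simp [coeff_one]
  | inv_of x h =>
    rw [coeff_magnus_inv 0 (mem_lowerCentralSeries_zero _), map_neg, h,
      GradedLCS.adExt_inv _ _ (mem_lowerCentralSeries_zero _)]
  | mul g h ihg ihh =>
    rw [coeff_magnus_mul 0 (mem_lowerCentralSeries_zero _) (mem_lowerCentralSeries_zero _),
      map_add, ihg, ihh, ← GradedLCS.adExt_mul]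

/-- The leading coefficient of the Magnus expansion of `g ∈ Γ_{k+1}` acts on the extended graded
group as the bracket with `g`. This contains the Dynkin–Specht–Wever identity: on the element that
represents the weight derivation, the bracket with `g` has the value `(k + 1) g`. -/
theorem gradedAction_coeff_magnus (k : ℕ) (g : FreeGroup X)
    (hg : g ∈ (⊤ : Subgroup (FreeGroup X)).lowerCentralSeries k) :
    gradedAction (coeff (k + 1) (magnus g : PowerSeries (FreeAssocRing X))) =
      GradedLCS.adExt k g hg := by
  induction k generalizing g with
  | zero => exact gradedAction_coeff_magnus_zero g
  | succ k ih =>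
    induction hg using Subgroup.closure_induction with
    | mem x hx =>
      obtain ⟨p, hp, q, -, rfl⟩ := hx
      rw [map_commutatorElement, (commutator_mem_unitsOneMod (magnus_mem_unitsOneMod k hp)
        (magnus_mem_unitsOneMod_zero q)).2, map_sub, map_mul, map_mul, ih p hp,
        gradedAction_coeff_magnus_zero q]
      exact (GradedLCS.adExt_commutator k 0 p q hp (Subgroup.mem_top _)).symm
    | one => rw [coeff_magnus_one, map_zero, GradedLCS.adExt_one]
    | mul x y hx hy ihx ihy =>
      rw [coeff_magnus_mul (k + 1) hx hy, map_add, ihx, ihy]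
      exact (GradedLCS.adExt_mul (k + 1) x y hx hy).symm
    | inv x hx ihx =>
      rw [coeff_magnus_inv (k + 1) hx, map_neg, ihx]
      exact (GradedLCS.adExt_inv (k + 1) x hx).symm

/-- Magnus' theorem up to torsion. -/
theorem pow_mem_of_coeff_magnus_eq_zero (k : ℕ) {g : FreeGroup X}
    (hg : g ∈ (⊤ : Subgroup (FreeGroup X)).lowerCentralSeries k)
    (h : coeff (k + 1) (magnus g : PowerSeries (FreeAssocRing X)) = 0) :
    g ^ (k + 1) ∈ (⊤ : Subgroup (FreeGroup X)).lowerCentralSeries (k + 1) := by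
  apply GradedLCS.pow_mem_of_adExt_eq_zero k g hg
  rw [← gradedAction_coeff_magnus, h, map_zero]

/-- Only scalars commute with two different letters: a non-empty word in the support of an element
that commutes with the letter `x` ends in `x`. -/
theorem FreeAssocRing.eq_scalar_of_commute {x y : X} (hxy : x ≠ y) {p : FreeAssocRing X}
    (hx : letter x * p = p * letter x) (hy : letter y * p = p * letter y) :
    ∃ z : ℤ, p = algebraMap ℤ (FreeAssocRing X) z := by
  have key : ∀ (x : X), letter x * p = p * letter x → ∀ v : FreeMonoid X, p.coeff v ≠ 0 →
      v ≠ 1 → ∃ v' : List X, v.toList = v' ++ [x] := by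
    intro x hx v hv hv1
    have h1 : (letter x * p).coeff (FreeMonoid.of x * v) = p.coeff v := by
      rw [letter, MonoidAlgebra.coeff_single_mul_eq_mul_coeff v (fun _ _ => mul_right_inj _),
        one_mul]
    have h2 : ∃ d, d * FreeMonoid.of x = FreeMonoid.of x * v := by
      by_contra! h
      rw [hx, letter, MonoidAlgebra.coeff_mul_single_of_forall_mul_ne _ _ h] at h1
      exact hv h1.symm
    obtain ⟨d, hd⟩ := h2
    have h3 : d.toList ++ [x] = [x] ++ v.toList := congrArg FreeMonoid.toList hd
    obtain h4 | ⟨v', b, h4⟩ := List.eq_nil_or_concat v.toList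
    · exact absurd (FreeMonoid.toList.injective h4) hv1
    · rw [h4, List.concat_eq_append, ← List.append_assoc] at h3
      have := (List.append_inj' h3 rfl).2
      exact ⟨v', by rw [h4, List.concat_eq_append, ← this]⟩
  refine ⟨p.coeff 1, ?_⟩
  rw [Algebra.algebraMap_eq_smul_one, MonoidAlgebra.one_def, MonoidAlgebra.smul_single]
  refine MonoidAlgebra.coeff_injective (Finsupp.ext fun v => ?_)
  by_cases hv : v = 1
  · subst hv; simp
  · have h0 : p.coeff v = 0 := by
      by_contra h
      obtain ⟨v₁, h₁⟩ := key x hx v h hv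
      obtain ⟨v₂, h₂⟩ := key y hy v h hv
      rw [h₁] at h₂
      exact hxy (by simpa using (List.append_inj' h₂ rfl).2)
    rw [h0]
    simp [Ne.symm hv]

/-- The leading coefficient is not a non-zero scalar: on the second factor `ℤ` of the extended
graded group a bracket is zero, while a scalar `z` acts as multiplication by `z`. -/
theorem eq_zero_of_coeff_magnus_eq_scalar (k : ℕ) {g : FreeGroup X}
    (hg : g ∈ (⊤ : Subgroup (FreeGroup X)).lowerCentralSeries k) {z : ℤ}
    (h : coeff (k + 1) (magnus g : PowerSeries (FreeAssocRing X)) = algebraMap ℤ _ z) : z = 0 := by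
  have h1 := gradedAction_coeff_magnus k g hg
  rw [h, AlgHom.commutes] at h1
  have h2 := congrArg Prod.snd (DFunLike.congr_fun h1 (0, 1))
  rw [GradedLCS.adExt_apply] at h2
  simpa using h2

/-- The leading coefficient of the Magnus expansion of an element of `Γ_{k+1}` vanishes if it
commutes with two different letters. -/
theorem coeff_magnus_eq_zero_of_commute {x y : X} (hxy : x ≠ y) (k : ℕ) {g : FreeGroup X}
    (hg : g ∈ (⊤ : Subgroup (FreeGroup X)).lowerCentralSeries k)
    (h : ∀ x, FreeAssocRing.letter x * coeff (k + 1) (magnus g : PowerSeries (FreeAssocRing X)) =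
      coeff (k + 1) (magnus g : PowerSeries (FreeAssocRing X)) * FreeAssocRing.letter x) :
    coeff (k + 1) (magnus g : PowerSeries (FreeAssocRing X)) = 0 := by
  obtain ⟨z, hz⟩ := FreeAssocRing.eq_scalar_of_commute hxy (h x) (h y)
  rw [hz, eq_zero_of_coeff_magnus_eq_scalar k hg hz, map_zero]

end Magnus

/-! ### Integer-valued polynomials and Hall polynomials -/

section HallPolynomials

/-- The product of binomial coefficients `∏ s, binom(x s, m s)`. -/
noncomputable def binomProd {σ R : Type*} [CommRing R] [BinomialRing R] (m : σ →₀ ℕ) (x : σ → R) :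
    R :=
  m.prod fun s k => Ring.choose (x s) k

theorem HallPolynomial.eval_eq {σ R : Type*} [CommRing R] [BinomialRing R] (P : HallPolynomial σ)
    (x : σ → R) : P.eval x = P.sum fun m z => (z : R) * binomProd m x := rfl

theorem descPochhammer_aeval_eq {R : Type*} [CommRing R] [BinomialRing R] (x : R) (k : ℕ) :
    Polynomial.aeval x (descPochhammer ℤ k) = (k.factorial : R) * Ring.choose x k := by
  rw [Polynomial.aeval_eq_smeval, Ring.descPochhammer_eq_factorial_smul_choose, nsmul_eq_mul]

theorem Ring.mul_choose (n : ℤ) (k : ℕ) :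
    n * Ring.choose n k = (k + 1) * Ring.choose n (k + 1) + k * Ring.choose n k := by
  have h1 := descPochhammer_aeval_eq n (k + 1)
  rw [descPochhammer_succ_right, map_mul, descPochhammer_aeval_eq, Nat.factorial_succ] at h1
  simp only [map_sub, Polynomial.aeval_X, map_natCast] at h1
  push_cast at h1
  have h2 : ((k.factorial : ℕ) : ℤ) ≠ 0 := by exact_mod_cast k.factorial_ne_zero
  apply mul_left_cancel₀ h2
  linarith

variable {σ τ : Type*}

theorem mul_binomProd (s : σ) (m : σ →₀ ℕ) (x : σ → ℤ) :
    x s * binomProd m x =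
      (m s + 1) * binomProd (m + Finsupp.single s 1) x + m s * binomProd m x := by
  have h : ∀ m : σ →₀ ℕ, binomProd m x =
      Ring.choose (x s) (m s) * (m.erase s).prod fun s k => Ring.choose (x s) k := fun m =>
    (Finsupp.mul_prod_erase' m s _ fun _ => Ring.choose_zero_right _).symm
  rw [h m, h (m + Finsupp.single s 1), Finsupp.erase_add, Finsupp.erase_single, add_zero,
    Finsupp.add_apply, Finsupp.single_eq_same]
  have := Ring.mul_choose (x s) (m s)
  linear_combination (((m.erase s).prod fun s k => Ring.choose (x s) k)) * this

/-- `F` is given by a polynomial with rational coefficients. -/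
def IsPolyFun (F : (σ → ℤ) → ℚ) : Prop :=
  ∃ P : MvPolynomial σ ℚ, ∀ x, F x = MvPolynomial.aeval (fun s => (x s : ℚ)) P

theorem IsPolyFun.exists_binomial_expansion {F : (σ → ℤ) → ℚ} (hF : IsPolyFun F) :
    ∃ e : (σ →₀ ℕ) →₀ ℚ, ∀ x, F x = e.sum fun m z => z * (binomProd m x : ℤ) := by
  obtain ⟨P, hP⟩ := hF
  let v : (σ →₀ ℕ) → (σ → ℤ) → ℚ := fun m x => (binomProd m x : ℤ)
  have key : (fun x : σ → ℤ => MvPolynomial.aeval (fun s => (x s : ℚ)) P) ∈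
      Submodule.span ℚ (Set.range v) := by
    clear hP
    induction P using MvPolynomial.induction_on with
    | C a =>
      have : (fun x : σ → ℤ => MvPolynomial.aeval (fun s => (x s : ℚ)) (MvPolynomial.C a)) =
          a • v 0 := by
        ext x
        simp [v, binomProd]
      rw [this]
      exact Submodule.smul_mem _ _ (Submodule.subset_span ⟨0, rfl⟩)
    | add p q hp hq =>
      simp only [map_add]
      exact Submodule.add_mem _ hp hq
    | mul_X p s hp =>
      simp only [map_mul, MvPolynomial.aeval_X]
      suffices h : ∀ f ∈ Submodule.span ℚ (Set.range v),
          (fun x : σ → ℤ => f x * (x s : ℚ)) ∈ Submodule.span ℚ (Set.range v) from h _ hp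
      intro f hf
      induction hf using Submodule.span_induction with
      | mem f hf =>
        obtain ⟨m, rfl⟩ := hf
        have : (fun x : σ → ℤ => v m x * (x s : ℚ)) =
            ((m s + 1 : ℕ) : ℚ) • v (m + Finsupp.single s 1) + ((m s : ℕ) : ℚ) • v m := by
          ext x
          have := congrArg (Int.cast : ℤ → ℚ) (mul_binomProd s m x)
          push_cast at this
          simp only [v, Pi.add_apply, Pi.smul_apply, smul_eq_mul]
          push_cast
          linarith
        rw [this]
        exact Submodule.add_mem _ (Submodule.smul_mem _ _ (Submodule.subset_span ⟨_, rfl⟩))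
          (Submodule.smul_mem _ _ (Submodule.subset_span ⟨_, rfl⟩))
      | zero => simp only [Pi.zero_apply, zero_mul]; exact Submodule.zero_mem _
      | add f g _ _ hf hg =>
        simp only [Pi.add_apply, add_mul]
        exact Submodule.add_mem _ hf hg
      | smul a f _ hf =>
        simp only [Pi.smul_apply, smul_eq_mul, mul_assoc]
        exact Submodule.smul_mem _ a hf
  obtain ⟨e, he⟩ := Finsupp.mem_span_range_iff_exists_finsupp.1 key
  refine ⟨e, fun x => ?_⟩
  rw [hP, ← congrFun he x, Finsupp.sum_apply']
  rfl

/-- The coefficients of an integer-valued polynomial in the binomial basis are integers: the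
coefficient at `m` is found, by induction on `m`, from the value at the point `m`, where all
products of binomial coefficients vanish but those with exponents at most `m`. -/
theorem exists_hallPolynomial_eval_eq {F : (σ → ℤ) → ℤ} (hF : IsPolyFun fun x => (F x : ℚ)) :
    ∃ P : HallPolynomial σ, ∀ x, P.eval x = F x := by
  classical
  obtain ⟨e, he⟩ := hF.exists_binomial_expansion
  have key : ∀ n : ℕ, ∀ m : σ →₀ ℕ, m.degree = n → ∃ z : ℤ, e m = z := by
    intro n
    induction n using Nat.strong_induction_on with
    | _ n ih =>
    intro m hm
    have hself : binomProd m (fun s => (m s : ℤ)) = 1 := by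
      refine Finset.prod_eq_one fun s _ => ?_
      simp only [Ring.choose_natCast, Nat.choose_self, Nat.cast_one]
    have hterm : ∀ m' ∈ e.support.erase m,
        ∃ z : ℤ, e m' * ((binomProd m' (fun s => (m s : ℤ)) : ℤ) : ℚ) = z := by
      intro m' hm'
      by_cases hle : m' ≤ m
      · have hlt : m' < m := lt_of_le_of_ne hle (Finset.ne_of_mem_erase hm')
        have hdeg : m'.degree < n := by
          obtain ⟨d, rfl⟩ := exists_add_of_le hle
          rw [← hm, map_add]
          have : d.degree ≠ 0 := by
            rw [Ne, Finsupp.degree_eq_zero_iff]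
            rintro rfl
            simp at hlt
          omega
        obtain ⟨z, hz⟩ := ih _ hdeg m' rfl
        exact ⟨z * binomProd m' (fun s => (m s : ℤ)), by rw [hz]; push_cast; rfl⟩
      · refine ⟨0, ?_⟩
        obtain ⟨s, hs⟩ : ∃ s, m s < m' s := by
          by_contra! h
          exact hle h
        have : binomProd m' (fun s => (m s : ℤ)) = 0 := by
          refine Finset.prod_eq_zero (i := s) (by rw [Finsupp.mem_support_iff]; omega) ?_
          simp only [Ring.choose_natCast, Nat.choose_eq_zero_of_lt hs, Nat.cast_zero]
        rw [this]
        simp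
    choose! z hz using hterm
    have h := he (fun s => (m s : ℤ))
    by_cases hmem : m ∈ e.support
    · rw [Finsupp.sum, ← Finset.add_sum_erase _ _ hmem, hself, Finset.sum_congr rfl hz] at h
      refine ⟨F (fun s => (m s : ℤ)) - ∑ m' ∈ e.support.erase m, z m', ?_⟩
      push_cast
      rw [h]
      push_cast
      ring
    · exact ⟨0, by simpa using hmem⟩
  refine ⟨e.mapRange Rat.num Rat.num_zero, fun x => ?_⟩
  have hnum : ∀ m, ((e m).num : ℚ) = e m := fun m => by
    obtain ⟨z, hz⟩ := key _ m rfl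
    rw [hz, Rat.num_intCast]
  apply Int.cast_injective (α := ℚ)
  rw [he, HallPolynomial.eval_eq, Finsupp.sum_mapRange_index (by simp), Finsupp.sum, Finsupp.sum]
  push_cast
  simp only [hnum]

/-- The polynomial `binom(P, k)` with rational coefficients. -/
noncomputable def choosePoly (P : MvPolynomial σ ℚ) (k : ℕ) : MvPolynomial σ ℚ :=
  MvPolynomial.C ((k.factorial : ℚ)⁻¹) * Polynomial.aeval P (descPochhammer ℤ k)

theorem aeval_choosePoly {R K : Type*} [CommRing R] [BinomialRing R] [Field K] [Algebra ℚ K]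
    (φ : R →+* K) {P : MvPolynomial σ ℚ} {y : σ → K} {x : R}
    (h : MvPolynomial.aeval y P = φ x) (k : ℕ) :
    MvPolynomial.aeval y (choosePoly P k) = φ (Ring.choose x k) := by
  have h1 : MvPolynomial.aeval y (Polynomial.aeval P (descPochhammer ℤ k)) =
      Polynomial.aeval (φ x) (descPochhammer ℤ k) := by
    rw [← h, Polynomial.aeval_def, Polynomial.aeval_def, ← AlgHom.coe_toRingHom,
      Polynomial.hom_eval₂]
    congr 1
    exact RingHom.ext_int _ _
  have h2 : φ (Polynomial.aeval x (descPochhammer ℤ k)) =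
      Polynomial.aeval (φ x) (descPochhammer ℤ k) := by
    rw [Polynomial.aeval_def, Polynomial.aeval_def, Polynomial.hom_eval₂]
    congr 1
    exact RingHom.ext_int _ _
  have h3 : algebraMap ℚ K (k.factorial : ℚ)⁻¹ * (k.factorial : K) = 1 := by
    rw [← map_natCast (algebraMap ℚ K), ← map_mul,
      inv_mul_cancel₀ (by exact_mod_cast k.factorial_ne_zero), map_one]
  rw [choosePoly, map_mul, MvPolynomial.aeval_C, h1, ← h2, descPochhammer_aeval_eq, map_mul,
    map_natCast, ← mul_assoc, h3, one_mul]

namespace IsPolyFun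

variable {F G : (σ → ℤ) → ℚ}

theorem const (q : ℚ) : IsPolyFun fun _ : σ → ℤ => q := ⟨MvPolynomial.C q, fun x => by simp⟩

theorem coord (s : σ) : IsPolyFun fun x : σ → ℤ => (x s : ℚ) :=
  ⟨MvPolynomial.X s, fun x => by simp⟩

theorem add (hF : IsPolyFun F) (hG : IsPolyFun G) : IsPolyFun fun x => F x + G x := by
  obtain ⟨P, hP⟩ := hF
  obtain ⟨Q, hQ⟩ := hG
  exact ⟨P + Q, fun x => by simp only [map_add, hP, hQ]⟩

theorem mul (hF : IsPolyFun F) (hG : IsPolyFun G) : IsPolyFun fun x => F x * G x := by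
  obtain ⟨P, hP⟩ := hF
  obtain ⟨Q, hQ⟩ := hG
  exact ⟨P * Q, fun x => by simp only [map_mul, hP, hQ]⟩

theorem neg (hF : IsPolyFun F) : IsPolyFun fun x => - F x := by
  obtain ⟨P, hP⟩ := hF
  exact ⟨-P, fun x => by simp only [map_neg, hP]⟩

theorem choose {F : (σ → ℤ) → ℤ} (hF : IsPolyFun fun x => (F x : ℚ)) (k : ℕ) :
    IsPolyFun fun x => ((Ring.choose (F x) k : ℤ) : ℚ) := by
  obtain ⟨P, hP⟩ := hF
  exact ⟨choosePoly P k, fun x => (aeval_choosePoly (Int.castRingHom ℚ) (hP x).symm k).symm⟩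

end IsPolyFun

variable (σ) in
/-- The additive group of the polynomial maps from `ℤ ^ σ` to an abelian group `A`, generated by the
maps `x ↦ F(x) v` for integer-valued polynomials `F` and elements `v` of `A`. -/
def polyMaps (A : Type*) [AddCommGroup A] : AddSubgroup ((σ → ℤ) → A) :=
  AddSubgroup.closure {Φ | ∃ F : (σ → ℤ) → ℤ, IsPolyFun (fun x => (F x : ℚ)) ∧ ∃ v,
    Φ = fun x => F x • v}

section PolyMaps

variable {A : Type*} [AddCommGroup A]

theorem const_mem_polyMaps (v : A) : (fun _ => v) ∈ polyMaps σ A :=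
  AddSubgroup.subset_closure ⟨fun _ => 1, by simpa using IsPolyFun.const 1, v, by simp⟩

theorem smul_mem_polyMaps {F : (σ → ℤ) → ℤ} (hF : IsPolyFun fun x => (F x : ℚ))
    {Φ : (σ → ℤ) → A} (hΦ : Φ ∈ polyMaps σ A) : (fun x => F x • Φ x) ∈ polyMaps σ A := by
  induction hΦ using AddSubgroup.closure_induction with
  | mem Φ h =>
    obtain ⟨G, hG, v, rfl⟩ := h
    exact AddSubgroup.subset_closure ⟨fun x => F x * G x, by
      simpa only [Int.cast_mul] using hF.mul hG, v, by ext x; rw [mul_smul]⟩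
  | zero => simp only [Pi.zero_apply, smul_zero]; exact zero_mem _
  | add Φ Ψ _ _ h h' => simp only [Pi.add_apply, smul_add]; exact add_mem h h'
  | neg Φ _ h => simp only [Pi.neg_apply, smul_neg]; exact neg_mem h

theorem mul_mem_polyMaps {B : Type*} [Ring B] {Φ Ψ : (σ → ℤ) → B} (hΦ : Φ ∈ polyMaps σ B)
    (hΨ : Ψ ∈ polyMaps σ B) : (fun x => Φ x * Ψ x) ∈ polyMaps σ B := by
  induction hΦ using AddSubgroup.closure_induction with
  | mem Φ h =>
    obtain ⟨F, hF, v, rfl⟩ := h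
    induction hΨ using AddSubgroup.closure_induction with
    | mem Ψ h =>
      obtain ⟨G, hG, v', rfl⟩ := h
      exact AddSubgroup.subset_closure ⟨fun x => F x * G x, by
        simpa only [Int.cast_mul] using hF.mul hG, v * v', by ext x; rw [smul_mul_smul_comm]⟩
    | zero => simp only [Pi.zero_apply, mul_zero]; exact zero_mem _
    | add Φ Ψ _ _ h h' => simp only [Pi.add_apply, mul_add]; exact add_mem h h'
    | neg Φ _ h => simp only [Pi.neg_apply, mul_neg]; exact neg_mem h
  | zero => simp only [Pi.zero_apply, zero_mul]; exact zero_mem _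
  | add Φ Ψ _ _ h h' => simp only [Pi.add_apply, add_mul]; exact add_mem h h'
  | neg Φ _ h => simp only [Pi.neg_apply, neg_mul]; exact neg_mem h

theorem sum_mem_polyMaps {ι : Type*} (s : Finset ι) {Φ : ι → (σ → ℤ) → A}
    (h : ∀ i ∈ s, Φ i ∈ polyMaps σ A) : (fun x => ∑ i ∈ s, Φ i x) ∈ polyMaps σ A := by
  have := sum_mem h
  convert this using 1
  ext x
  rw [Finset.sum_apply]

theorem isPolyFun_of_mem_polyMaps {Φ : (σ → ℤ) → A} (hΦ : Φ ∈ polyMaps σ A) (l : A →+ ℚ) :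
    IsPolyFun fun x => l (Φ x) := by
  induction hΦ using AddSubgroup.closure_induction with
  | mem Φ h =>
    obtain ⟨F, hF, v, rfl⟩ := h
    simpa only [map_zsmul, zsmul_eq_mul] using hF.mul (IsPolyFun.const (l v))
  | zero => simpa only [Pi.zero_apply, map_zero] using IsPolyFun.const 0
  | add Φ Ψ _ _ h h' => simpa only [Pi.add_apply, map_add] using h.add h'
  | neg Φ _ h => simpa only [Pi.neg_apply, map_neg] using h.neg

end PolyMaps

end HallPolynomials

/-! ### Binomial expansion of powers of power series -/

section PolySeries

open PowerSeries

variable {σ : Type*} {B : Type*} [Ring B]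

theorem PowerSeries.coeff_pow_of_vanish {v : PowerSeries B} (hv : coeff 0 v = 0) (j : ℕ) :
    ∀ k < j, coeff k (v ^ j) = 0 := by
  induction j with
  | zero => simp
  | succ j ih =>
    rw [pow_succ]
    exact (coeff_mul_of_vanish ih (n := 1) (by simpa using hv)).1

/-- The binomial series for integer exponents, modulo `X ^ (K + 1)`. -/
theorem eqUpTo_zpow (K : ℕ) {u : (PowerSeries B)ˣ} (hu : u ∈ unitsOneMod B 0) (n : ℤ) :
    EqUpTo K ((u ^ n : (PowerSeries B)ˣ) : PowerSeries B)
      (∑ j ∈ Finset.range (K + 1), Ring.choose n j • ((u : PowerSeries B) - 1) ^ j) := by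
  set v : PowerSeries B := (u : PowerSeries B) - 1 with hv
  have hv0 : coeff 0 v = 0 := coeff_sub_one_of_mem hu 0 (by omega)
  set S : ℤ → PowerSeries B := fun n => ∑ j ∈ Finset.range (K + 1), Ring.choose n j • v ^ j with hS
  have step : ∀ n, EqUpTo K ((u : PowerSeries B) * S n) (S (n + 1)) := by
    intro n
    have e : S (n + 1) + Ring.choose n K • v ^ (K + 1) = (u : PowerSeries B) * S n := by
      have e1 : S (n + 1) =
          ∑ j ∈ Finset.range K, (Ring.choose n j + Ring.choose n (j + 1)) • v ^ (j + 1) + 1 := by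
        simp only [hS]
        rw [Finset.sum_range_succ']
        simp [Ring.choose_succ_succ]
      have e2 : S n = ∑ j ∈ Finset.range K, Ring.choose n (j + 1) • v ^ (j + 1) + 1 := by
        simp only [hS]
        rw [Finset.sum_range_succ']
        simp
      have e3 : v * S n = ∑ j ∈ Finset.range K, Ring.choose n j • v ^ (j + 1) +
          Ring.choose n K • v ^ (K + 1) := by
        simp only [hS]
        rw [Finset.mul_sum, Finset.sum_range_succ]
        simp only [mul_smul_comm, pow_succ']
      have e4 : (u : PowerSeries B) * S n = S n + v * S n := by
        rw [hv]; noncomm_ring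
      rw [e4, e3, e1]
      nth_rewrite 1 [e2]
      simp only [add_smul, Finset.sum_add_distrib]
      abel
    intro k hk
    rw [← e, map_add, map_zsmul, coeff_pow_of_vanish hv0 _ k (by omega), smul_zero, add_zero]
  change EqUpTo K _ (S n)
  induction n using Int.induction_on with
  | zero =>
    have : S 0 = 1 := by
      simp only [hS]
      rw [Finset.sum_range_succ']
      simp
    rw [this, zpow_zero]
    exact EqUpTo.refl _ _
  | succ n ih =>
    rw [zpow_add_one, ← (Commute.refl u).zpow_right n, Units.val_mul]
    exact (EqUpTo.mul (EqUpTo.refl _ _) ih).trans (step n)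
  | pred n ih =>
    have h := step (-(n : ℤ) - 1)
    rw [sub_add_cancel] at h
    have h2 := EqUpTo.mul (EqUpTo.refl K ((u⁻¹ : (PowerSeries B)ˣ) : PowerSeries B))
      (ih.trans h.symm)
    rw [← mul_assoc, Units.inv_mul, one_mul, ← Units.val_mul] at h2
    rwa [zpow_sub_one, ((Commute.refl u).zpow_left (-(n : ℤ))).inv_right.eq]

/-- All coefficients of the power series `Φ a` are polynomial maps of `a`. -/
def IsPolySeries (Φ : (σ → ℤ) → PowerSeries B) : Prop :=
  ∀ k, (fun a => coeff k (Φ a)) ∈ polyMaps σ B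

namespace IsPolySeries

theorem const (b : PowerSeries B) : IsPolySeries fun _ : σ → ℤ => b :=
  fun _ => const_mem_polyMaps _

theorem mul {Φ Ψ : (σ → ℤ) → PowerSeries B} (hΦ : IsPolySeries Φ) (hΨ : IsPolySeries Ψ) :
    IsPolySeries fun a => Φ a * Ψ a := by
  intro k
  simp only [coeff_mul]
  exact sum_mem_polyMaps _ fun x _ => mul_mem_polyMaps (hΦ _) (hΨ _)

theorem pow {Φ : (σ → ℤ) → PowerSeries B} (hΦ : IsPolySeries Φ) (j : ℕ) :
    IsPolySeries fun a => Φ a ^ j := by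
  induction j with
  | zero => simpa only [pow_zero] using const 1
  | succ j ih => simpa only [pow_succ] using ih.mul hΦ

theorem zpow {Φ : (σ → ℤ) → (PowerSeries B)ˣ} (hΦ : IsPolySeries fun a => (Φ a : PowerSeries B))
    (hmem : ∀ a, Φ a ∈ unitsOneMod B 0) {F : (σ → ℤ) → ℤ} (hF : IsPolyFun fun a => (F a : ℚ)) :
    IsPolySeries fun a => ((Φ a ^ F a : (PowerSeries B)ˣ) : PowerSeries B) := by
  intro k
  have h : ∀ a, coeff k ((Φ a ^ F a : (PowerSeries B)ˣ) : PowerSeries B) =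
      ∑ j ∈ Finset.range (k + 1),
        Ring.choose (F a) j • coeff k (((Φ a : PowerSeries B) - 1) ^ j) := fun a => by
    rw [eqUpTo_zpow k (hmem a) (F a) k le_rfl, map_sum]
    simp only [map_zsmul]
  simp only [h]
  refine sum_mem_polyMaps _ fun j _ => smul_mem_polyMaps (hF.choose j) ?_
  refine IsPolySeries.pow (Φ := fun a => (Φ a : PowerSeries B) - 1) (fun i => ?_) j k
  simp only [map_sub]
  exact sub_mem (hΦ i) (const_mem_polyMaps _)

end IsPolySeries

end PolySeries

/-! ### Ordered products -/

section OrderedProd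

theorem orderedProd_eq_map {G : Type*} [Group G] {N : ℕ} (u : Fin N → G) (a : Fin N → ℤ) :
    orderedProd u a = ((List.finRange N).map fun i => u i ^ a i).prod := by
  rw [orderedProd, List.ofFn_eq_map]

variable {G H : Type*} [Group G] [Group H] {N : ℕ}

theorem map_orderedProd (φ : G →* H) (u : Fin N → G) (a : Fin N → ℤ) :
    φ (orderedProd u a) = orderedProd (fun i => φ (u i)) a := by
  rw [orderedProd_eq_map, orderedProd_eq_map, map_list_prod, List.map_map]
  simp [Function.comp_def]

theorem orderedProd_zero (u : Fin N → G) : orderedProd u 0 = 1 := by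
  rw [orderedProd_eq_map]
  exact List.prod_eq_one (by simp)

theorem orderedProd_mem {K : Subgroup G} {u : Fin N → G} {a : Fin N → ℤ}
    (h : ∀ i, u i ^ a i ∈ K) : orderedProd u a ∈ K := by
  rw [orderedProd_eq_map]
  exact K.list_prod_mem (by simpa using h)

theorem orderedProd_succ (u : Fin (N + 1) → G) (a : Fin (N + 1) → ℤ) :
    orderedProd u a = u 0 ^ a 0 * orderedProd (fun i => u i.succ) fun i => a i.succ := by
  rw [orderedProd, List.ofFn_succ, List.prod_cons, orderedProd]

theorem orderedProd_single (u : Fin N → G) (j : Fin N) : orderedProd u (Pi.single j 1) = u j := by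
  induction N with
  | zero => exact j.elim0
  | succ N ih =>
    rw [orderedProd_succ]
    cases j using Fin.cases with
    | zero =>
      have : (fun i : Fin N =>
          (Pi.single (0 : Fin (N + 1)) (1 : ℤ) : Fin (N + 1) → ℤ) i.succ) = 0 := by
        ext i; simp
      rw [this, orderedProd_zero]
      simp
    | succ j =>
      have : (fun i : Fin N => (Pi.single j.succ (1 : ℤ) : Fin (N + 1) → ℤ) i.succ) =
          Pi.single j 1 := by
        ext i; simp [Pi.single_apply]
      rw [this, ih (fun i => u i.succ)]
      simp

/-- Exponents supported on consecutive index ranges can be merged. -/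
theorem orderedProd_add_of_separated (u : Fin N → G) (a b : Fin N → ℤ)
    (h : ∀ i j, a i ≠ 0 → b j ≠ 0 → i < j) :
    orderedProd u (a + b) = orderedProd u a * orderedProd u b := by
  induction N with
  | zero => simp [orderedProd]
  | succ N ih =>
    by_cases hb : b 0 = 0
    · rw [orderedProd_succ, orderedProd_succ u a, orderedProd_succ u b, hb, zpow_zero, one_mul,
        mul_assoc, ← ih _ _ _ fun i j hi hj => Fin.succ_lt_succ_iff.1 (h _ _ hi hj)]
      simp [hb, Pi.add_def]
    · have ha : a = 0 := by
        ext i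
        by_contra hi
        exact absurd (h i 0 hi hb) (Fin.not_lt_zero i)
      rw [ha, zero_add, orderedProd_zero, one_mul]

/-- Central factors can be merged. -/
theorem orderedProd_add_of_central (u : Fin N → G) (a b : Fin N → ℤ)
    (h : ∀ i, u i ^ b i ∈ Subgroup.center G) :
    orderedProd u (a + b) = orderedProd u a * orderedProd u b := by
  induction N with
  | zero => simp [orderedProd]
  | succ N ih =>
    have e := ih (fun i => u i.succ) (fun i => a i.succ) (fun i => b i.succ) fun i => h i.succ
    rw [orderedProd_succ, orderedProd_succ u a, orderedProd_succ u b, Pi.add_apply, zpow_add]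
    change _ * orderedProd (fun i => u i.succ) ((fun i => a i.succ) + fun i => b i.succ) = _
    rw [e]
    have hc := Subgroup.mem_center_iff.1 (h 0) (orderedProd (fun i => u i.succ) fun i => a i.succ)
    simp only [mul_assoc]
    rw [← mul_assoc (u 0 ^ b 0), ← hc, mul_assoc]

/-- Powers of products of commuting factors are computed factor by factor. -/
theorem orderedProd_mul_of_commute (u : Fin N → G) (a : Fin N → ℤ) (m : ℕ)
    (h : ∀ i j, Commute (u i ^ a i) (u j ^ a j)) :
    orderedProd u (fun i => a i * m) = orderedProd u a ^ m := by
  rw [orderedProd_eq_map, orderedProd_eq_map]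
  generalize List.finRange N = l
  induction l with
  | nil => simp
  | cons i l ih =>
    have hc : Commute (u i ^ a i) (l.map fun i => u i ^ a i).prod :=
      Commute.list_prod_right _ _ (by simpa using fun j _ => h i j)
    rw [List.map_cons, List.prod_cons, List.map_cons, List.prod_cons, ih, hc.mul_pow, zpow_mul,
      zpow_natCast]

theorem extendLevel_apply {A : Type*} [Zero A] (w : Fin N → ℕ) (k : ℕ) (e : Level w k → A)
    (i : Level w k) : extendLevel w k e i = e i := by
  simp [extendLevel, i.2]

theorem extendLevel_of_ne {A : Type*} [Zero A] {w : Fin N → ℕ} {k : ℕ} (e : Level w k → A)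
    {i : Fin N} (h : w i ≠ k) : extendLevel w k e i = 0 := by
  simp [extendLevel, h]

end OrderedProd

/-! ### Magnus expansions of ordered products -/

section LeadingTerm

open PowerSeries

variable {B : Type*} [Ring B]

theorem eqUpTo_mul_monomial {k : ℕ} {a : PowerSeries B} (ha : coeff 0 a = 1) (s : B) :
    EqUpTo k (a * monomial k s) (monomial k s) := by
  have h := coeff_mul_of_vanish (m := 0) (n := k) (a := a) (b := monomial k s) (by simp)
    (fun j hj => by rw [coeff_monomial, if_neg (by omega)])
  rw [zero_add] at h
  intro j hj
  rcases hj.lt_or_eq with h1 | rfl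
  · rw [h.1 j h1, coeff_monomial, if_neg (by omega)]
  · rw [h.2, ha, one_mul]

theorem eqUpTo_monomial_mul {k : ℕ} {a : PowerSeries B} (ha : coeff 0 a = 1) (s : B) :
    EqUpTo k (monomial k s * a) (monomial k s) := by
  have h := coeff_mul_of_vanish (m := k) (n := 0) (a := monomial k s) (b := a)
    (fun j hj => by rw [coeff_monomial, if_neg (by omega)]) (by simp)
  rw [add_zero] at h
  intro j hj
  rcases hj.lt_or_eq with h1 | rfl
  · rw [h.1 j h1, coeff_monomial, if_neg (by omega)]
  · rw [h.2, ha, mul_one, coeff_monomial, if_pos rfl]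

theorem EqUpTo.add {n : ℕ} {a b a' b' : PowerSeries B} (h : EqUpTo n a b) (h' : EqUpTo n a' b') :
    EqUpTo n (a + a') (b + b') := fun k hk => by rw [map_add, map_add, h k hk, h' k hk]

theorem coeff_succ_zpow_of_mem {n : ℕ} {u : (PowerSeries B)ˣ} (hu : u ∈ unitsOneMod B n) (m : ℤ) :
    coeff (n + 1) ((u ^ m : (PowerSeries B)ˣ) : PowerSeries B) =
      m • coeff (n + 1) (u : PowerSeries B) := by
  induction m using Int.induction_on with
  | zero => simp [coeff_one]
  | succ m ih =>
    rw [zpow_add_one, coeff_succ_mul_of_mem (zpow_mem hu _) hu, ih, add_smul, one_smul]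
  | pred m ih =>
    have h := coeff_succ_mul_of_mem (zpow_mem hu (-(m : ℤ) - 1)) hu
    rw [← zpow_add_one, sub_add_cancel, ih] at h
    rw [sub_smul, one_smul, h, add_sub_cancel_right]

/-- In a product of powers of units `m i` congruent to `1` modulo `X ^ (w i)`, the exponents of the
units with `w i = k` enter the coefficient at `k` linearly, and those with `w i > k` do not
enter. -/
theorem eqUpTo_list_prod {ι : Type*} (w : ι → ℕ) (m : ι → (PowerSeries B)ˣ)
    (hm : ∀ i, m i ∈ unitsOneMod B (w i - 1)) (k : ℕ) (hk : 1 ≤ k) (d : ι → ℤ) (l : List ι) :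
    EqUpTo k (((l.map fun i => m i ^ d i).prod : (PowerSeries B)ˣ) : PowerSeries B)
      ((((l.map fun i => m i ^ (if w i < k then d i else 0)).prod : (PowerSeries B)ˣ) :
        PowerSeries B) +
        monomial k (l.map fun i => if w i = k then d i • coeff (w i) (m i : PowerSeries B)
          else 0).sum) := by
  have h0 : ∀ i (n : ℤ), coeff 0 ((m i ^ n : (PowerSeries B)ˣ) : PowerSeries B) = 1 := fun i n => by
    simpa using (zpow_mem (hm i) n : m i ^ n ∈ unitsOneMod B (w i - 1)) 0 (by omega)
  have h0' : ∀ (l : List ι) (n : ι → ℤ),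
      coeff 0 (((l.map fun i => m i ^ n i).prod : (PowerSeries B)ˣ) : PowerSeries B) = 1 := by
    intro l n
    have : (l.map fun i => m i ^ n i).prod ∈ unitsOneMod B 0 := by
      refine Subgroup.list_prod_mem _ fun x hx => ?_
      obtain ⟨i, -, rfl⟩ := List.mem_map.1 hx
      exact zpow_mem (EqUpTo.mono (hm i) (by omega)) _
    simpa using this 0 le_rfl
  induction l with
  | nil => simpa using EqUpTo.refl k 1
  | cons i l ih =>
    simp only [List.map_cons, List.prod_cons, List.sum_cons, Units.val_mul]
    set Q := (((l.map fun i => m i ^ d i).prod : (PowerSeries B)ˣ) : PowerSeries B)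
    set Q' := (((l.map fun i => m i ^ (if w i < k then d i else 0)).prod : (PowerSeries B)ˣ) :
      PowerSeries B) with hQ'
    set s := (l.map fun i => if w i = k then d i • coeff (w i) (m i : PowerSeries B) else 0).sum
    by_cases h : w i < k
    · simp only [h, h.ne, if_true, if_false, zero_add]
      refine (EqUpTo.mul (EqUpTo.refl _ _) ih).trans ?_
      rw [mul_add]
      exact (EqUpTo.refl _ _).add (eqUpTo_mul_monomial (h0 i _) s)
    · have ha : EqUpTo k ((m i ^ d i : (PowerSeries B)ˣ) : PowerSeries B)
          (1 + monomial k (if w i = k then d i • coeff (w i) (m i : PowerSeries B) else 0)) := by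
        intro j hj
        have hz := zpow_mem (hm i) (d i)
        by_cases h1 : w i = k
        · rw [if_pos h1]
          rcases hj.lt_or_eq with h2 | rfl
          · rw [hz j (by omega), map_add, coeff_monomial, if_neg (by omega), add_zero]
          · have e : w i - 1 + 1 = j := by omega
            have h3 := coeff_succ_zpow_of_mem (hm i) (d i)
            rw [e] at h3
            rw [h3, map_add, coeff_one, if_neg (by omega), coeff_monomial, if_pos rfl, zero_add, h1]
        · rw [if_neg h1, map_zero, add_zero]
          exact hz j (by omega)
      simp only [h, if_false, zpow_zero, Units.val_one, one_mul]
      refine (EqUpTo.mul ha ih).trans ?_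
      rw [add_mul, one_mul, add_assoc, map_add, add_comm (monomial k _) (monomial k s)]
      refine (EqUpTo.refl _ _).add ((EqUpTo.refl _ _).add (eqUpTo_monomial_mul ?_ _))
      have hzero : coeff 0 (monomial k s) = 0 := by rw [coeff_monomial, if_neg (by omega)]
      rw [map_add, hzero, add_zero]
      exact h0' l _

end LeadingTerm

/-! ### Hall basic sequences in the free group -/

namespace IsHallBasicSequence

open PowerSeries

variable {G : Type*} [Group G] {N r c : ℕ} {w : Fin N → ℕ} {u : Fin N → G}

theorem _root_.IsCommutatorOfWeight.mem_lowerCentralSeries {S : Set G} {n : ℕ} {x : G}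
    (h : IsCommutatorOfWeight S n x) :
    1 ≤ n ∧ x ∈ (⊤ : Subgroup G).lowerCentralSeries (n - 1) := by
  induction h with
  | base x hx => exact ⟨le_rfl, Subgroup.mem_top x⟩
  | comm m n x y hx hy ihx ihy =>
    refine ⟨by omega, ?_⟩
    have e : x⁻¹ * y⁻¹ * x * y = ⁅x⁻¹, y⁻¹⁆ := by simp [commutatorElement_def]
    rw [e]
    exact commutator_mem_lowerCentralSeries (inv_mem ihx.2) (inv_mem ihy.2) (by omega)

section Lift

variable (hu : IsHallBasicSequence r c w u)
include hu

theorem mem_lowerCentralSeries_pred (i : Fin N) :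
    u i ∈ (⊤ : Subgroup G).lowerCentralSeries (w i - 1) :=
  (hu.isCommutator i).mem_lowerCentralSeries.2

theorem map_lift_lowerCentralSeries (k : ℕ) :
    ((⊤ : Subgroup (FreeGroup (Level w 1))).lowerCentralSeries k).map
      (FreeGroup.lift fun k : Level w 1 => u k) = (⊤ : Subgroup G).lowerCentralSeries k := by
  rw [Subgroup.map_lowerCentralSeries, Subgroup.map_top_of_surjective _ hu.free.surjective]

theorem lowerCentralSeries_eq_bot : (⊤ : Subgroup G).lowerCentralSeries c = ⊥ := by
  rw [← hu.map_lift_lowerCentralSeries, Subgroup.map_eq_bot_iff, hu.free.ker_eq]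

theorem exists_lift : ∃ v : Fin N → FreeGroup (Level w 1), ∀ i,
    FreeGroup.lift (fun k : Level w 1 => u k) (v i) = u i ∧
      v i ∈ (⊤ : Subgroup (FreeGroup (Level w 1))).lowerCentralSeries (w i - 1) := by
  have h : ∀ i, ∃ x : FreeGroup (Level w 1), FreeGroup.lift (fun k : Level w 1 => u k) x = u i ∧
      x ∈ (⊤ : Subgroup (FreeGroup (Level w 1))).lowerCentralSeries (w i - 1) := by
    intro i
    have := hu.mem_lowerCentralSeries_pred i
    rw [← hu.map_lift_lowerCentralSeries] at this
    obtain ⟨x, hx, hxu⟩ := this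
    exact ⟨x, hxu, hx⟩
  choose v hv using h
  exact ⟨v, hv⟩

end Lift

variable (hu : IsHallBasicSequence r c w u)

/-- Preimages of the `u i` in the free group, chosen in the same term of the lower central
series. -/
noncomputable def freeLift : Fin N → FreeGroup (Level w 1) := hu.exists_lift.choose

theorem lift_freeLift (i : Fin N) :
    FreeGroup.lift (fun k : Level w 1 => u k) (hu.freeLift i) = u i :=
  (hu.exists_lift.choose_spec i).1

theorem freeLift_mem (i : Fin N) : hu.freeLift i ∈
    (⊤ : Subgroup (FreeGroup (Level w 1))).lowerCentralSeries (w i - 1) :=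
  (hu.exists_lift.choose_spec i).2

theorem lift_orderedProd_freeLift (a : Fin N → ℤ) :
    FreeGroup.lift (fun k : Level w 1 => u k) (orderedProd hu.freeLift a) = orderedProd u a := by
  rw [map_orderedProd]
  simp only [hu.lift_freeLift]

include hu in
/-- The Magnus expansion modulo `X ^ (c + 1)` is well defined on `G`. -/
theorem eqUpTo_magnus_of_lift_eq {x y : FreeGroup (Level w 1)}
    (h : FreeGroup.lift (fun k : Level w 1 => u k) x =
      FreeGroup.lift (fun k : Level w 1 => u k) y) :
    EqUpTo c (magnus x : PowerSeries (FreeAssocRing (Level w 1))) (magnus y) := by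
  have h1 : x * y⁻¹ ∈ (⊤ : Subgroup (FreeGroup (Level w 1))).lowerCentralSeries c := by
    rw [← hu.free.ker_eq, MonoidHom.mem_ker, map_mul, map_inv, h, mul_inv_cancel]
  have h2 := EqUpTo.mul (magnus_mem_unitsOneMod c h1)
    (EqUpTo.refl c (magnus y : PowerSeries (FreeAssocRing (Level w 1))))
  rwa [← Units.val_mul, ← map_mul, inv_mul_cancel_right, one_mul] at h2

/-- The Magnus expansion of `u ^ d`, which is well defined modulo `X ^ (c + 1)`. -/
noncomputable def expansion (d : Fin N → ℤ) : (PowerSeries (FreeAssocRing (Level w 1)))ˣ :=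
  magnus (orderedProd hu.freeLift d)

/-- The leading coefficient of the Magnus expansion of `u i`. -/
noncomputable def leadingCoeff (i : Fin N) : FreeAssocRing (Level w 1) :=
  coeff (w i) (magnus (hu.freeLift i) : PowerSeries (FreeAssocRing (Level w 1)))

theorem expansion_mul_of_eq {a b d : Fin N → ℤ}
    (h : orderedProd u a * orderedProd u b = orderedProd u d) :
    EqUpTo c (hu.expansion a * hu.expansion b : PowerSeries (FreeAssocRing (Level w 1)))
      (hu.expansion d) := by
  have := hu.eqUpTo_magnus_of_lift_eq (x := orderedProd hu.freeLift a * orderedProd hu.freeLift b)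
    (y := orderedProd hu.freeLift d) (by simpa only [map_mul, hu.lift_orderedProd_freeLift] using h)
  rwa [map_mul, Units.val_mul] at this

/-- The exponents of weight `k` enter the coefficient at `k` linearly, through the leading
coefficients of the `u i`; the rest of that coefficient is determined by the exponents of smaller
weight. -/
theorem coeff_expansion (k : ℕ) (hk : 1 ≤ k) (d : Fin N → ℤ) :
    coeff k (hu.expansion d : PowerSeries (FreeAssocRing (Level w 1))) =
      coeff k (hu.expansion (lowPart w k d) : PowerSeries (FreeAssocRing (Level w 1))) +
        ∑ i : Level w k, d i • hu.leadingCoeff i := by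
  set m : Fin N → (PowerSeries (FreeAssocRing (Level w 1)))ˣ := fun i => magnus (hu.freeLift i)
  have hm : ∀ i, m i ∈ unitsOneMod (FreeAssocRing (Level w 1)) (w i - 1) :=
    fun i => magnus_mem_unitsOneMod _ (hu.freeLift_mem i)
  have h0 := eqUpTo_list_prod w m hm k hk d (List.finRange N)
  have h := h0 k le_rfl
  have e : ∀ d : Fin N → ℤ, hu.expansion d =
      ((List.finRange N).map fun i => magnus (hu.freeLift i) ^ d i).prod := fun d => by
    rw [expansion, map_orderedProd, orderedProd_eq_map]
  have hs : ((List.finRange N).map fun i => if w i = k then d i • hu.leadingCoeff i else 0).sum =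
      ∑ i : Level w k, d i • hu.leadingCoeff i := by
    rw [← Fin.sum_univ_def, ← Finset.sum_filter]
    exact Finset.sum_subtype (p := fun i => w i = k) _ (by simp) _
  rw [e, e, ← hs]
  rw [map_add, coeff_monomial, if_pos rfl] at h
  exact h

theorem expansion_zero : hu.expansion 0 = 1 := by rw [expansion, orderedProd_zero, map_one]

theorem coeff_expansion_of_low {k : ℕ} (hk : 1 ≤ k) {d : Fin N → ℤ} (hd : ∀ i, w i < k → d i = 0) :
    coeff k (hu.expansion d : PowerSeries (FreeAssocRing (Level w 1))) =
        ∑ i : Level w k, d i • hu.leadingCoeff i := by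
  have : lowPart w k d = 0 := by
    ext i
    by_cases h : w i < k
    · simp [lowPart, h, hd i h]
    · simp [lowPart, h]
  rw [hu.coeff_expansion k hk, this, hu.expansion_zero, Units.val_one, coeff_one, if_neg (by omega),
    zero_add]

theorem orderedProd_freeLift_mem {k : ℕ} {d : Fin N → ℤ} (hd : ∀ i, w i ≤ k → d i = 0) :
    orderedProd hu.freeLift d ∈
      (⊤ : Subgroup (FreeGroup (Level w 1))).lowerCentralSeries k := by
  refine orderedProd_mem fun i => ?_
  by_cases h : w i ≤ k
  · rw [hd i h, zpow_zero]; exact one_mem _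
  · exact zpow_mem (Subgroup.lowerCentralSeries_antitone _ (by omega) (hu.freeLift_mem i)) _

/-- The leading coefficients of the Magnus expansions of the `u i` of weight `k` are linearly
independent: a combination that vanishes gives an element of `Γ_k / Γ_{k+1}` that is torsion by
Magnus' theorem, and this group is free abelian on the `u i`. -/
theorem linearIndependent_leadingCoeff {k : ℕ} (hk : 1 ≤ k) (hkc : k ≤ c) :
    LinearIndependent ℤ fun i : Level w k => hu.leadingCoeff i := by
  obtain ⟨k, rfl⟩ : ∃ k', k = k' + 1 := ⟨k - 1, by omega⟩
  rw [Fintype.linearIndependent_iff]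
  intro e he
  set d := extendLevel w (k + 1) e with hd
  have hd0 : ∀ i, w i ≠ k + 1 → d i = 0 := fun i hi => extendLevel_of_ne e hi
  have hx := hu.orderedProd_freeLift_mem (k := k) (d := d) fun i hi => hd0 i (by omega)
  have hcoeff : coeff (k + 1) (hu.expansion d : PowerSeries (FreeAssocRing (Level w 1))) = 0 := by
    rw [hu.coeff_expansion_of_low hk fun i hi => hd0 i (by omega), ← he]
    exact Finset.sum_congr rfl fun i _ => by rw [hd, extendLevel_apply]
  have hpow := Subgroup.mem_map_of_mem (FreeGroup.lift fun k : Level w 1 => u k)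
    (pow_mem_of_coeff_magnus_eq_zero k hx hcoeff)
  rw [hu.map_lift_lowerCentralSeries, map_pow, hu.lift_orderedProd_freeLift] at hpow
  have hmem : ∀ i, u i ^ d i ∈ (⊤ : Subgroup G).lowerCentralSeries k := fun i => by
    by_cases h : w i = k + 1
    · have := hu.mem_lowerCentralSeries_pred i
      rw [h, Nat.add_sub_cancel] at this
      exact zpow_mem this _
    · rw [hd0 i h, zpow_zero]; exact one_mem _
  have hpow' : orderedProd u (fun i => d i * (k + 1 : ℕ)) ∈
      (⊤ : Subgroup G).lowerCentralSeries (k + 1) := by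
    rw [← QuotientGroup.eq_one_iff] at hpow ⊢
    rw [QuotientGroup.mk_pow] at hpow
    have h1 : ∀ a : Fin N → ℤ,
        ((orderedProd u a : G) : G ⧸ (⊤ : Subgroup G).lowerCentralSeries (k + 1)) =
        orderedProd (fun i => (u i : G ⧸ (⊤ : Subgroup G).lowerCentralSeries (k + 1))) a :=
      fun a => map_orderedProd (QuotientGroup.mk' _) u a
    rw [h1] at hpow ⊢
    rw [orderedProd_mul_of_commute, hpow]
    intro i j
    exact commute_mk_lowerCentralSeries (hmem i) (hmem j) (by omega)
  obtain ⟨e', -, huniq⟩ := hu.basis k (by omega) 1 (one_mem _)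
  have h1 := huniq (fun i => e i * (k + 1 : ℕ)) (by
    beta_reduce
    rw [mul_one]
    refine inv_mem ?_
    convert hpow' using 2
    ext i
    by_cases h : w i = k + 1
    · simp [hd, extendLevel, h]
    · simp [hd, extendLevel, h])
  have h2 := huniq 0 (by
    have : extendLevel w (k + 1) (0 : Level w (k + 1) → ℤ) = 0 := by
      ext i; simp [extendLevel]
    beta_reduce
    rw [this, orderedProd_zero, inv_one, one_mul]
    exact one_mem _)
  intro i
  have h3 := congrFun (h1.trans h2.symm) i
  simp only [Pi.zero_apply, mul_eq_zero] at h3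
  rcases h3 with h3 | h3
  · exact h3
  · exfalso; push_cast at h3; omega

/-- The Magnus expansion determines the exponents. -/
theorem exponent_eq_of_eqUpTo {m : ℕ} (hm : m ≤ c) {a b : Fin N → ℤ}
    (h : EqUpTo m (hu.expansion a : PowerSeries (FreeAssocRing (Level w 1))) (hu.expansion b)) :
    ∀ i, w i ≤ m → a i = b i := by
  suffices hk : ∀ k ≤ m, ∀ i, w i = k → a i = b i from fun i hi => hk (w i) hi i rfl
  intro k
  induction k using Nat.strong_induction_on with
  | _ k ih =>
  intro hkm i hi
  have hk1 : 1 ≤ k := hi ▸ hu.one_le_weight i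
  have hlow : lowPart w k a = lowPart w k b := by
    ext j
    by_cases hj : w j < k
    · simp [lowPart, hj, ih (w j) hj (by omega) j rfl]
    · simp [lowPart, hj]
  have h1 := h k hkm
  rw [hu.coeff_expansion k hk1, hu.coeff_expansion k hk1 b, hlow, add_right_inj] at h1
  have h2 := Fintype.linearIndependent_iff.1 (hu.linearIndependent_leadingCoeff hk1 (hkm.trans hm))
    (fun i => a i - b i) (by simp only [sub_smul, Finset.sum_sub_distrib, h1, sub_self]) ⟨i, hi⟩
  exact sub_eq_zero.1 h2

include hu in
theorem orderedProd_injective : Function.Injective (orderedProd u) := by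
  intro a b h
  have := hu.eqUpTo_magnus_of_lift_eq (x := orderedProd hu.freeLift a)
    (y := orderedProd hu.freeLift b) (by simpa only [hu.lift_orderedProd_freeLift] using h)
  exact funext fun i => hu.exponent_eq_of_eqUpTo le_rfl this i (hu.weight_le i)

include hu in
theorem orderedProd_surjective : Function.Surjective (orderedProd u) := by
  -- descending induction on `k`, splitting off the factors of weight `k + 1`
  have key : ∀ n k : ℕ, k + n = c → ∀ g ∈ (⊤ : Subgroup G).lowerCentralSeries k,
      ∃ a : Fin N → ℤ, (∀ i, w i ≤ k → a i = 0) ∧ orderedProd u a = g := by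
    intro n
    induction n with
    | zero =>
      intro k hk g hg
      rw [add_zero] at hk
      rw [hk, hu.lowerCentralSeries_eq_bot, Subgroup.mem_bot] at hg
      exact ⟨0, fun _ _ => rfl, by rw [orderedProd_zero, hg]⟩
    | succ n ih =>
      intro k hk g hg
      obtain ⟨e, he, -⟩ := hu.basis k (by omega) g hg
      obtain ⟨b, hb, hbg⟩ := ih (k + 1) (by omega) _ he
      refine ⟨extendLevel w (k + 1) e + b, fun i hi => ?_, ?_⟩
      · rw [Pi.add_apply, extendLevel_of_ne e (by omega), hb i (by omega), add_zero]
      · rw [orderedProd_add_of_separated, hbg, mul_inv_cancel_left]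
        intro i j hi hj
        have hi' : w i = k + 1 := by
          by_contra h; exact hi (extendLevel_of_ne e h)
        have hj' : k + 1 < w j := by
          by_contra h; exact hj (hb j (by omega))
        exact hu.weight_mono.reflect_lt (by omega)
  intro g
  obtain ⟨a, -, ha⟩ := key c 0 (by omega) g (Subgroup.mem_top g)
  exact ⟨a, ha⟩

end IsHallBasicSequence

/-! ### Existence of the canonical polynomials -/

section LeftInverse

/-- Coordinates with respect to a family that is linearly independent over `ℤ`, as a `ℚ`-linear map
on a rational vector space that contains the family. -/
theorem LinearIndependent.exists_rat_leftInverse {κ A V : Type*} [Fintype κ] [AddCommGroup A]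
    [AddCommGroup V] [Module ℚ V] (j : A →+ V) (hj : Function.Injective j) {θ : κ → A}
    (hθ : LinearIndependent ℤ θ) :
    ∃ L : V →ₗ[ℚ] (κ → ℚ), ∀ e : κ → ℤ, L (j (∑ i, e i • θ i)) = fun i => (e i : ℚ) := by
  classical
  have h1 : LinearIndependent ℤ (fun i => j (θ i)) :=
    hθ.map' j.toIntLinearMap (LinearMap.ker_eq_bot.2 hj)
  rw [LinearIndependent.iff_fractionRing ℤ ℚ] at h1
  obtain ⟨L, hL⟩ := LinearMap.exists_leftInverse_of_injective
    (Fintype.linearCombination ℚ fun i => j (θ i))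
    (LinearMap.ker_eq_bot.2 h1.fintypeLinearCombination_injective)
  refine ⟨L, fun e => ?_⟩
  have h2 := LinearMap.congr_fun hL fun i => (e i : ℚ)
  rw [LinearMap.comp_apply, LinearMap.id_apply, Fintype.linearCombination_apply] at h2
  rw [← h2]
  congr 1
  rw [map_sum]
  exact Finset.sum_congr rfl fun i _ => by rw [map_zsmul, Int.cast_smul_eq_zsmul]

/-- The embedding of the free associative ring into the rational vector space on the words. -/
noncomputable def FreeAssocRing.toRat (X : Type*) : FreeAssocRing X →+ (FreeMonoid X →₀ ℚ) :=
  (Finsupp.mapRange.addMonoidHom (Int.castAddHom ℚ)).comp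
    (MonoidAlgebra.coeffAddEquiv : FreeAssocRing X ≃+ (FreeMonoid X →₀ ℤ)).toAddMonoidHom

theorem FreeAssocRing.toRat_injective (X : Type*) :
    Function.Injective (FreeAssocRing.toRat X) :=
  (Finsupp.mapRange_injective (Int.cast : ℤ → ℚ) Int.cast_zero Int.cast_injective).comp
    (MonoidAlgebra.coeff_injective (R := ℤ) (M := FreeMonoid X))

end LeftInverse

namespace IsHallBasicSequence

open PowerSeries

variable {G : Type*} [Group G] {N r c : ℕ} {w : Fin N → ℕ} {u : Fin N → G}
  (hu : IsHallBasicSequence r c w u)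

theorem isPolySeries_expansion {σ : Type*} {d : Fin N → (σ → ℤ) → ℤ}
    (hd : ∀ i, IsPolyFun fun x => (d i x : ℚ)) :
    IsPolySeries fun x =>
      (hu.expansion fun i => d i x : PowerSeries (FreeAssocRing (Level w 1))) := by
  have e : ∀ x, hu.expansion (fun i => d i x) =
      ((List.finRange N).map fun i => magnus (hu.freeLift i) ^ d i x).prod := fun x => by
    rw [expansion, map_orderedProd, orderedProd_eq_map]
  simp only [e]
  generalize List.finRange N = l
  induction l with
  | nil => simpa using IsPolySeries.const 1
  | cons i l ih =>
    simp only [List.map_cons, List.prod_cons, Units.val_mul]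
    exact (IsPolySeries.zpow (IsPolySeries.const _)
      (fun _ => magnus_mem_unitsOneMod_zero _) (hd i)).mul ih

/-- If the Magnus expansion of `u ^ d(x)` is a polynomial map of `x`, then so is `d`: the exponents
of weight `k` are found from the coefficient at `k` by subtracting the contribution of the exponents
of smaller weight. -/
theorem isPolyFun_of_isPolySeries {σ : Type*} {d : Fin N → (σ → ℤ) → ℤ}
    {Φ : (σ → ℤ) → PowerSeries (FreeAssocRing (Level w 1))} (hΦ : IsPolySeries Φ)
    (h : ∀ x, EqUpTo c (Φ x) (hu.expansion fun i => d i x)) (i : Fin N) :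
    IsPolyFun fun x => (d i x : ℚ) := by
  suffices hk : ∀ k, ∀ i, w i = k → IsPolyFun fun x => (d i x : ℚ) from hk (w i) i rfl
  intro k
  induction k using Nat.strong_induction_on with
  | _ k ih =>
  intro i hi
  have hk1 : 1 ≤ k := hi ▸ hu.one_le_weight i
  have hkc : k ≤ c := hi ▸ hu.weight_le i
  have hlow : IsPolySeries fun x =>
      (hu.expansion (lowPart w k fun i => d i x) : PowerSeries (FreeAssocRing (Level w 1))) := by
    refine hu.isPolySeries_expansion (d := fun i x => lowPart w k (fun i => d i x) i) fun j => ?_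
    by_cases hj : w j < k
    · simpa only [lowPart, hj, if_true] using ih (w j) hj j rfl
    · simpa only [lowPart, hj, if_false, Int.cast_zero] using IsPolyFun.const 0
  obtain ⟨L, hL⟩ := (hu.linearIndependent_leadingCoeff hk1 hkc).exists_rat_leftInverse
    (FreeAssocRing.toRat _) (FreeAssocRing.toRat_injective _)
  have h1 := isPolyFun_of_mem_polyMaps (sub_mem (hΦ k) (hlow k))
    ((LinearMap.proj (R := ℚ) (φ := fun _ : Level w k => ℚ) ⟨i, hi⟩ ∘ₗ L).toAddMonoidHom.comp
      (FreeAssocRing.toRat (Level w 1)))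
  refine (congrArg IsPolyFun (funext fun x => ?_)).mp h1
  have h2 := h x k hkc
  rw [hu.coeff_expansion k hk1] at h2
  have h3 := congrFun (hL fun j => d j x) ⟨i, hi⟩
  rw [← h3]
  change L (FreeAssocRing.toRat _ (coeff k (Φ x) - coeff k _)) ⟨i, hi⟩ = _
  rw [h2, add_sub_cancel_left]

include hu in
/-- The exponents of `u ^ a * u ^ b` are given by Hall polynomials. -/
theorem exists_describesProduct : ∃ p, DescribesProduct u p := by
  choose d hd using fun x : (Fin N ⊕ Fin N) → ℤ => hu.orderedProd_surjective
    (orderedProd u (fun i => x (Sum.inl i)) * orderedProd u fun i => x (Sum.inr i))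
  have h := fun i => exists_hallPolynomial_eval_eq (hu.isPolyFun_of_isPolySeries
    (d := fun i x => d x i)
    ((hu.isPolySeries_expansion fun i => IsPolyFun.coord (Sum.inl i)).mul
      (hu.isPolySeries_expansion fun i => IsPolyFun.coord (Sum.inr i)))
    (fun x => hu.expansion_mul_of_eq (hd x).symm) i)
  choose p hp using h
  refine ⟨p, fun a b => ?_⟩
  simp only [hp]
  exact (hd (Sum.elim a b)).symm

include hu in
/-- The exponents of `(u ^ a) ^ l` are given by Hall polynomials. -/
theorem exists_describesPower : ∃ q, DescribesPower u q := by
  choose d hd using fun x : (Fin N ⊕ Unit) → ℤ => hu.orderedProd_surjective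
    (orderedProd u (fun i => x (Sum.inl i)) ^ x (Sum.inr ()))
  have hexp : ∀ x, EqUpTo c (((hu.expansion fun i => x (Sum.inl i)) ^ x (Sum.inr ()) :
      (PowerSeries (FreeAssocRing (Level w 1)))ˣ) : PowerSeries (FreeAssocRing (Level w 1)))
      (hu.expansion fun i => d x i) := by
    intro x
    have := hu.eqUpTo_magnus_of_lift_eq
      (x := orderedProd hu.freeLift (fun i => x (Sum.inl i)) ^ x (Sum.inr ()))
      (y := orderedProd hu.freeLift (d x))
      (by simpa only [map_zpow, hu.lift_orderedProd_freeLift] using (hd x).symm)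
    rwa [map_zpow] at this
  have h := fun i => exists_hallPolynomial_eval_eq (hu.isPolyFun_of_isPolySeries
    (d := fun i x => d x i)
    ((hu.isPolySeries_expansion fun i => IsPolyFun.coord (Sum.inl i)).zpow
      (fun x => magnus_mem_unitsOneMod_zero _) (IsPolyFun.coord (Sum.inr ())))
    hexp i)
  choose p hp using h
  refine ⟨p, fun a l => ?_⟩
  simp only [hp]
  exact (hd (Sum.elim a fun _ => l)).symm

/-! ### The group law on integer exponents -/

section
include hu

theorem orderedProd_hallMul (a b : Fin N → ℤ) :
    orderedProd u (hallMul u a b) = orderedProd u a * orderedProd u b :=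
  (Classical.epsilon_spec hu.exists_describesProduct a b).symm

theorem orderedProd_hallInv (a : Fin N → ℤ) :
    orderedProd u (hallInv u a) = (orderedProd u a)⁻¹ := by
  rw [← zpow_neg_one]
  exact (Classical.epsilon_spec hu.exists_describesPower a (-1)).symm

theorem hallMul_assoc_int (a b d : Fin N → ℤ) :
    hallMul u (hallMul u a b) d = hallMul u a (hallMul u b d) :=
  hu.orderedProd_injective (by simp only [hu.orderedProd_hallMul, mul_assoc])

theorem zero_hallMul_int (a : Fin N → ℤ) : hallMul u 0 a = a :=
  hu.orderedProd_injective (by rw [hu.orderedProd_hallMul, orderedProd_zero, one_mul])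

theorem hallMul_zero_int (a : Fin N → ℤ) : hallMul u a 0 = a :=
  hu.orderedProd_injective (by rw [hu.orderedProd_hallMul, orderedProd_zero, mul_one])

theorem hallInv_hallMul_int (a : Fin N → ℤ) : hallMul u (hallInv u a) a = 0 :=
  hu.orderedProd_injective (by
    rw [hu.orderedProd_hallMul, hu.orderedProd_hallInv, orderedProd_zero, inv_mul_cancel])

theorem zpow_mem_center_of_weight {i : Fin N} (hi : w i = c) (n : ℤ) :
    u i ^ n ∈ Subgroup.center G := by
  refine zpow_mem (Subgroup.mem_center_iff.2 fun g => ?_) n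
  have h := commutator_mem_lowerCentralSeries (mem_lowerCentralSeries_zero g)
    (hu.mem_lowerCentralSeries_pred i) (n := c) (by omega)
  rw [hu.lowerCentralSeries_eq_bot, Subgroup.mem_bot] at h
  exact (commutatorElement_eq_one_iff_mul_comm.1 h)

theorem zpow_topPart_mem_center (z : Fin N → ℤ) (i : Fin N) :
    u i ^ topPart w c z i ∈ Subgroup.center G := by
  by_cases hi : w i = c
  · exact hu.zpow_mem_center_of_weight hi _
  · rw [topPart, extendLevel_of_ne _ hi, zpow_zero]
    exact one_mem _

theorem hallMul_add_topPart_int (a b z z' : Fin N → ℤ) :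
    hallMul u (a + topPart w c z) (b + topPart w c z') =
      hallMul u a b + topPart w c z + topPart w c z' := by
  have hc := hu.zpow_topPart_mem_center
  apply hu.orderedProd_injective
  rw [hu.orderedProd_hallMul, orderedProd_add_of_central u _ _ (hc z),
    orderedProd_add_of_central u _ _ (hc z'), orderedProd_add_of_central u _ _ (hc z'),
    orderedProd_add_of_central u _ _ (hc z), hu.orderedProd_hallMul]
  have h := Subgroup.mem_center_iff.1 (orderedProd_mem (hc z)) (orderedProd u b)
  rw [mul_assoc (orderedProd u a), ← mul_assoc (orderedProd u (topPart w c z)), ← h]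
  simp only [mul_assoc]

theorem hallMul_apply_of_weight_one_int (hc : 1 ≤ c) (a b : Fin N → ℤ) {i : Fin N} (hi : w i = 1) :
    hallMul u a b i = a i + b i := by
  have hlow : ∀ (d : Fin N → ℤ) (i), w i < 1 → d i = 0 := fun d i h =>
    absurd (hu.one_le_weight i) (by omega)
  have h := hu.expansion_mul_of_eq (hu.orderedProd_hallMul a b).symm 1 hc
  have h1 := coeff_succ_mul_of_mem (magnus_mem_unitsOneMod_zero (orderedProd hu.freeLift a))
    (magnus_mem_unitsOneMod_zero (orderedProd hu.freeLift b))
  replace h := h1.symm.trans h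
  have e := fun d : Fin N → ℤ => hu.coeff_expansion_of_low le_rfl (hlow d)
  change coeff 1 (hu.expansion a : PowerSeries (FreeAssocRing (Level w 1))) +
    coeff 1 (hu.expansion b : PowerSeries (FreeAssocRing (Level w 1))) = _ at h
  simp only [e] at h
  have h2 := Fintype.linearIndependent_iff.1 (hu.linearIndependent_leadingCoeff le_rfl hc)
    (fun i => hallMul u a b i - (a i + b i))
    (by simp only [sub_smul, add_smul, Finset.sum_sub_distrib, Finset.sum_add_distrib, h, sub_self])
    ⟨i, hi⟩
  exact sub_eq_zero.1 h2

end

theorem coeff_one_magnus_freeLift (hc : 1 ≤ c) (j : Level w 1) :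
    coeff 1 (magnus (hu.freeLift j) : PowerSeries (FreeAssocRing (Level w 1))) =
      FreeAssocRing.letter j := by
  have h := hu.eqUpTo_magnus_of_lift_eq (x := hu.freeLift j) (y := FreeGroup.of j)
    (by rw [hu.lift_freeLift, FreeGroup.lift_apply_of]) 1 hc
  rw [h, magnus_of]
  simp [coeff_one]

/-- A linear combination of the leading coefficients of the `u i` of weight `k` vanishes if it
commutes with all letters, because there are at least two of them. -/
theorem linearIndependent_leadingCoeff_commutator (hr : 2 ≤ r) {k : ℕ} (hk : 1 ≤ k) (hkc : k ≤ c) :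
    LinearIndependent ℤ fun (i : Level w k) (j : Level w 1) =>
      hu.leadingCoeff i * FreeAssocRing.letter j - FreeAssocRing.letter j * hu.leadingCoeff i := by
  rw [Fintype.linearIndependent_iff]
  intro e he
  obtain ⟨x, y, hxy⟩ := Fintype.one_lt_card_iff.1
    (show 1 < Fintype.card (Level w 1) by rw [hu.card_level_one]; omega)
  obtain ⟨k, rfl⟩ : ∃ k', k = k' + 1 := ⟨k - 1, by omega⟩
  set d := extendLevel w (k + 1) e with hd
  have hd0 : ∀ i, w i ≠ k + 1 → d i = 0 := fun i hi => extendLevel_of_ne e hi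
  have hx := hu.orderedProd_freeLift_mem (k := k) (d := d) fun i hi => hd0 i (by omega)
  have hcoeff : coeff (k + 1) (hu.expansion d : PowerSeries (FreeAssocRing (Level w 1))) =
      ∑ i : Level w (k + 1), e i • hu.leadingCoeff i := by
    rw [hu.coeff_expansion_of_low hk fun i hi => hd0 i (by omega)]
    exact Finset.sum_congr rfl fun i _ => by rw [hd, extendLevel_apply]
  have h0 := coeff_magnus_eq_zero_of_commute hxy k hx fun j => by
    change _ * coeff (k + 1) (hu.expansion d : PowerSeries (FreeAssocRing (Level w 1))) =
      coeff (k + 1) (hu.expansion d : PowerSeries (FreeAssocRing (Level w 1))) * _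
    rw [hcoeff]
    have h := congrFun he j
    rw [Finset.sum_apply] at h
    simp only [Pi.smul_apply, smul_sub, Finset.sum_sub_distrib, Pi.zero_apply] at h
    rw [Finset.mul_sum, Finset.sum_mul]
    simp only [mul_smul_comm, smul_mul_assoc]
    exact (sub_eq_zero.1 h).symm
  exact Fintype.linearIndependent_iff.1 (hu.linearIndependent_leadingCoeff hk hkc) e
    (hcoeff.symm.trans h0)

include hu in
/-- The exponents of weight `k < c` of an element of `Γ_k` can be read off from its commutation with
the generators, by linear expressions with rational coefficients. -/
theorem exists_exponent_formula (hr : 2 ≤ r) {k : ℕ} (hk : 1 ≤ k) (hkc : k < c) :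
    ∃ ψ : Level w k → Level w 1 → Level w (k + 1) → ℚ, ∀ a : Fin N → ℤ,
      (∀ i, w i < k → a i = 0) → ∀ i : Level w k,
        (a i : ℚ) = ∑ j : Level w 1, ∑ l : Level w (k + 1),
          (((hallMul u a (Pi.single (j : Fin N) 1) l : ℤ) : ℚ) -
            ((hallMul u (Pi.single (j : Fin N) 1) a l : ℤ) : ℚ)) * ψ i j l := by
  classical
  let incl : (Level w 1 → FreeAssocRing (Level w 1)) →+
      (Level w 1 → FreeMonoid (Level w 1) →₀ ℚ) :=
    (FreeAssocRing.toRat (Level w 1)).compLeft (Level w 1)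
  have hincl : Function.Injective incl :=
    (FreeAssocRing.toRat_injective (Level w 1)).comp_left
  obtain ⟨L, hL⟩ := (hu.linearIndependent_leadingCoeff_commutator hr hk
    hkc.le).exists_rat_leftInverse incl hincl
  refine ⟨fun i j l => L (incl (Pi.single j (hu.leadingCoeff l))) i, fun a ha i => ?_⟩
  have key : (∑ i : Level w k, a i • fun j : Level w 1 =>
      hu.leadingCoeff i * FreeAssocRing.letter j - FreeAssocRing.letter j * hu.leadingCoeff i) =
      ∑ j : Level w 1, ∑ l : Level w (k + 1),
        (hallMul u a (Pi.single (j : Fin N) 1) l - hallMul u (Pi.single (j : Fin N) 1) a l) •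
          (Pi.single j (hu.leadingCoeff l) : Level w 1 → FreeAssocRing (Level w 1)) := by
    ext1 j
    simp only [Finset.sum_apply, Pi.smul_apply]
    rw [Finset.sum_eq_single j
      (fun j' _ hne => by simp [Pi.single_eq_of_ne hne.symm]) (by simp)]
    simp only [Pi.single_eq_same]
    set b : Fin N → ℤ := Pi.single (j : Fin N) 1 with hb
    set x : PowerSeries (FreeAssocRing (Level w 1)) := (hu.expansion a).val
    set y : PowerSeries (FreeAssocRing (Level w 1)) := (hu.expansion b).val
    have h1 := hu.expansion_mul_of_eq (hu.orderedProd_hallMul a b).symm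
    have h2 := hu.expansion_mul_of_eq (hu.orderedProd_hallMul b a).symm
    have hx : ∀ m < k, coeff m (x - 1) = 0 := by
      have := coeff_sub_one_of_mem (magnus_mem_unitsOneMod (k - 1)
        (hu.orderedProd_freeLift_mem (k := k - 1) (d := a) fun i hi => ha i (by omega)))
      exact fun m hm => this m (by omega)
    have hy : ∀ m < 1, coeff m (y - 1) = 0 :=
      coeff_sub_one_of_mem (magnus_mem_unitsOneMod_zero _)
    have hxy := coeff_mul_of_vanish hx hy
    have hyx := coeff_mul_of_vanish hy hx
    rw [add_comm 1 k] at hyx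
    have e : x * y - y * x =
        (x - 1) * (y - 1) -
          (y - 1) * (x - 1) := by
      noncomm_ring
    -- the exponents of the two products agree up to weight `k`
    have hlow : ∀ i, w i ≤ k → hallMul u a b i = hallMul u b a i := by
      refine hu.exponent_eq_of_eqUpTo hkc.le (EqUpTo.trans (h1.mono hkc.le).symm ?_)
      refine EqUpTo.trans (fun m hm => ?_) (h2.mono hkc.le)
      rw [← sub_eq_zero, ← map_sub, e, map_sub, hxy.1 m (by omega), hyx.1 m (by omega), sub_self]
    have hpart : lowPart w (k + 1) (hallMul u a b) = lowPart w (k + 1) (hallMul u b a) := by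
      ext i
      by_cases hi : w i < k + 1
      · simp [lowPart, hi, hlow i (by omega)]
      · simp [lowPart, hi]
    have h3 := congrArg₂ (· - ·) (h1 (k + 1) hkc) (h2 (k + 1) hkc)
    beta_reduce at h3
    rw [hu.coeff_expansion (k + 1) (by omega), hu.coeff_expansion (k + 1) (by omega)
      (hallMul u b a), hpart, add_sub_add_left_eq_sub, ← map_sub, e, map_sub, hxy.2, hyx.2] at h3
    have hxk : coeff k (x - 1) =
        ∑ i : Level w k, a i • hu.leadingCoeff i := by
      rw [map_sub, hu.coeff_expansion_of_low hk ha, coeff_one, if_neg (by omega), sub_zero]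
    have hy1 : coeff 1 (y - 1) =
        FreeAssocRing.letter j := by
      rw [map_sub, coeff_one, if_neg (by omega), sub_zero,
        ← hu.coeff_one_magnus_freeLift (by omega) j, ← orderedProd_single hu.freeLift j]
      rfl
    rw [hxk, hy1, Finset.sum_mul, Finset.mul_sum] at h3
    simp only [smul_sub, sub_smul, Finset.sum_sub_distrib]
    simp only [smul_mul_assoc, mul_smul_comm] at h3
    exact h3
  have h4 := congrFun (hL fun i => a i) i
  rw [← h4, key]
  simp only [map_sum, Finset.sum_apply]
  refine Finset.sum_congr rfl fun j _ => Finset.sum_congr rfl fun l _ => ?_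
  rw [map_zsmul, map_zsmul, Pi.smul_apply, zsmul_eq_mul, Int.cast_sub]

end IsHallBasicSequence

/-! ### Transfer of polynomial identities from the integers to a binomial domain -/

section Transfer

variable {σ R : Type*} [CommRing R] [IsDomain R] [CharZero R]

/-- The functions `F` on integer points and `F'` on points of `R` are given by the same polynomial
with rational coefficients; the values of `F'` are taken in the field of fractions of `R`. -/
def SamePolynomial (F : (σ → ℤ) → ℚ) (F' : (σ → R) → FractionRing R) : Prop :=
  ∃ P : MvPolynomial σ ℚ, (∀ x, F x = MvPolynomial.aeval (fun s => (x s : ℚ)) P) ∧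
    ∀ x, F' x = MvPolynomial.aeval (fun s => algebraMap R (FractionRing R) (x s)) P

namespace SamePolynomial

variable {F F₁ F₂ : (σ → ℤ) → ℚ} {F' F₁' F₂' : (σ → R) → FractionRing R}

theorem eq_of_eq (h₁ : SamePolynomial F₁ F₁') (h₂ : SamePolynomial F₂ F₂')
    (h : ∀ x, F₁ x = F₂ x) (x : σ → R) : F₁' x = F₂' x := by
  obtain ⟨P, hP, hP'⟩ := h₁
  obtain ⟨Q, hQ, hQ'⟩ := h₂
  have : P = Q := by
    refine MvPolynomial.funext_set (fun _ => Set.range (Int.cast : ℤ → ℚ))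
      (fun _ => Set.infinite_range_of_injective Int.cast_injective) fun y hy => ?_
    choose z hz using fun s => hy s (Set.mem_univ s)
    obtain rfl : (fun s => (z s : ℚ)) = y := funext hz
    have := h z
    rw [hP, hQ] at this
    simpa only [MvPolynomial.aeval_eq_eval, RingHom.coe_coe] using this
  rw [hP', hQ', this]

theorem const (q : ℚ) : SamePolynomial (fun _ : σ → ℤ => q)
    fun _ : σ → R => algebraMap ℚ (FractionRing R) q :=
  ⟨MvPolynomial.C q, fun x => by simp, fun x => by simp⟩

theorem add (h₁ : SamePolynomial F₁ F₁') (h₂ : SamePolynomial F₂ F₂') :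
    SamePolynomial (fun x => F₁ x + F₂ x) fun x => F₁' x + F₂' x := by
  obtain ⟨P, hP, hP'⟩ := h₁
  obtain ⟨Q, hQ, hQ'⟩ := h₂
  exact ⟨P + Q, fun x => by simp only [map_add, hP, hQ], fun x => by simp only [map_add, hP', hQ']⟩

theorem mul (h₁ : SamePolynomial F₁ F₁') (h₂ : SamePolynomial F₂ F₂') :
    SamePolynomial (fun x => F₁ x * F₂ x) fun x => F₁' x * F₂' x := by
  obtain ⟨P, hP, hP'⟩ := h₁
  obtain ⟨Q, hQ, hQ'⟩ := h₂
  exact ⟨P * Q, fun x => by simp only [map_mul, hP, hQ], fun x => by simp only [map_mul, hP', hQ']⟩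

theorem sub (h₁ : SamePolynomial F₁ F₁') (h₂ : SamePolynomial F₂ F₂') :
    SamePolynomial (fun x => F₁ x - F₂ x) fun x => F₁' x - F₂' x := by
  obtain ⟨P, hP, hP'⟩ := h₁
  obtain ⟨Q, hQ, hQ'⟩ := h₂
  exact ⟨P - Q, fun x => by simp only [map_sub, hP, hQ], fun x => by simp only [map_sub, hP', hQ']⟩

theorem sum {ι : Type*} (s : Finset ι) {F : ι → (σ → ℤ) → ℚ} {F' : ι → (σ → R) → FractionRing R}
    (h : ∀ i ∈ s, SamePolynomial (F i) (F' i)) :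
    SamePolynomial (fun x => ∑ i ∈ s, F i x) fun x => ∑ i ∈ s, F' i x := by
  choose! P hP hP' using h
  exact ⟨∑ i ∈ s, P i, fun x => by rw [map_sum]; exact Finset.sum_congr rfl fun i hi => hP i hi x,
    fun x => by rw [map_sum]; exact Finset.sum_congr rfl fun i hi => hP' i hi x⟩

theorem prod {ι : Type*} (s : Finset ι) {F : ι → (σ → ℤ) → ℚ} {F' : ι → (σ → R) → FractionRing R}
    (h : ∀ i ∈ s, SamePolynomial (F i) (F' i)) :
    SamePolynomial (fun x => ∏ i ∈ s, F i x) fun x => ∏ i ∈ s, F' i x := by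
  choose! P hP hP' using h
  exact ⟨∏ i ∈ s, P i, fun x => by rw [map_prod]; exact Finset.prod_congr rfl fun i hi => hP i hi x,
    fun x => by rw [map_prod]; exact Finset.prod_congr rfl fun i hi => hP' i hi x⟩

end SamePolynomial

/-- The functions `F` on integer points and `F'` on points of `R` are given by the same
polynomial. -/
def SamePolynomialInt (F : (σ → ℤ) → ℤ) (F' : (σ → R) → R) : Prop :=
  SamePolynomial (fun x => (F x : ℚ)) fun x => algebraMap R (FractionRing R) (F' x)

namespace SamePolynomialInt

variable {F F₁ F₂ : (σ → ℤ) → ℤ} {F' F₁' F₂' : (σ → R) → R}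

theorem eq_of_eq (h₁ : SamePolynomialInt F₁ F₁') (h₂ : SamePolynomialInt F₂ F₂')
    (h : ∀ x, F₁ x = F₂ x) (x : σ → R) : F₁' x = F₂' x :=
  IsFractionRing.injective R (FractionRing R)
    (SamePolynomial.eq_of_eq h₁ h₂ (fun x => by rw [h x]) x)

theorem coord (s : σ) : SamePolynomialInt (fun x => x s) fun x : σ → R => x s :=
  ⟨MvPolynomial.X s, fun x => by simp, fun x => by simp⟩

theorem const (n : ℤ) : SamePolynomialInt (fun _ => n) fun _ : σ → R => (n : R) :=
  ⟨MvPolynomial.C n, fun x => by simp, fun x => by simp⟩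

theorem add (h₁ : SamePolynomialInt F₁ F₁') (h₂ : SamePolynomialInt F₂ F₂') :
    SamePolynomialInt (fun x => F₁ x + F₂ x) fun x => F₁' x + F₂' x := by
  simpa only [SamePolynomialInt, Int.cast_add, map_add] using SamePolynomial.add h₁ h₂

variable [BinomialRing R]

theorem choose (h : SamePolynomialInt F F') (k : ℕ) :
    SamePolynomialInt (fun x => Ring.choose (F x) k) fun x => Ring.choose (F' x) k := by
  obtain ⟨P, hP, hP'⟩ := h
  exact ⟨choosePoly P k,
    fun x => (aeval_choosePoly (Int.castRingHom ℚ) (hP x).symm k).symm,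
    fun x => (aeval_choosePoly (algebraMap R (FractionRing R)) (hP' x).symm k).symm⟩

/-- Substitution of polynomials in a Hall polynomial. -/
theorem eval {τ : Type*} (P : HallPolynomial τ) {F : τ → (σ → ℤ) → ℤ} {F' : τ → (σ → R) → R}
    (h : ∀ t, SamePolynomialInt (F t) (F' t)) :
    SamePolynomialInt (fun x => P.eval fun t => F t x) fun x => P.eval fun t => F' t x := by
  unfold SamePolynomialInt HallPolynomial.eval Finsupp.sum Finsupp.prod
  simp only [Int.cast_sum, Int.cast_mul, Int.cast_prod, Int.cast_id, map_sum, map_mul, map_prod]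
  refine SamePolynomial.sum _ fun m _ => SamePolynomial.mul ?_
    (SamePolynomial.prod _ fun t _ => (h t).choose (m t))
  exact const (P m)

end SamePolynomialInt

end Transfer

/-! ### The group law on exponents in a binomial domain -/

section Exponents

variable {G R : Type*} [Group G] [CommRing R] [BinomialRing R] {N r c : ℕ} {w : Fin N → ℕ}
  {u : Fin N → G}

omit [BinomialRing R] in
theorem topPart_apply (a : Fin N → R) (i : Fin N) :
    topPart w c a i = if w i = c then a i else 0 := by
  by_cases h : w i = c <;> simp [topPart, extendLevel, h]

variable [IsDomain R] [CharZero R]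

theorem SamePolynomialInt.hallMul {σ : Type*} {A B : Fin N → (σ → ℤ) → ℤ}
    {A' B' : Fin N → (σ → R) → R} (hA : ∀ i, SamePolynomialInt (A i) (A' i))
    (hB : ∀ i, SamePolynomialInt (B i) (B' i)) (i : Fin N) :
    SamePolynomialInt (fun x => hallMul u (fun i => A i x) (fun i => B i x) i)
      fun x => hallMul u (fun i => A' i x) (fun i => B' i x) i := by
  have h := SamePolynomialInt.eval (canonicalProduct u i) (F := Sum.elim A B) (F' := Sum.elim A' B')
    (by rintro (j | j); exacts [hA j, hB j])
  convert h using 3 <;>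
  · unfold _root_.hallMul
    congr 1
    ext (j | j) <;> rfl

theorem SamePolynomialInt.hallInv {σ : Type*} {A : Fin N → (σ → ℤ) → ℤ}
    {A' : Fin N → (σ → R) → R} (hA : ∀ i, SamePolynomialInt (A i) (A' i)) (i : Fin N) :
    SamePolynomialInt (fun x => hallInv u (fun i => A i x) i)
      fun x => hallInv u (fun i => A' i x) i := by
  have h := SamePolynomialInt.eval (canonicalPower u i) (F := Sum.elim A fun _ _ => -1)
    (F' := Sum.elim A' fun _ _ => -1)
    (by
      rintro (j | j)
      · exact hA j
      · simpa using SamePolynomialInt.const (R := R) (σ := σ) (-1))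
  convert h using 3 <;>
  · unfold _root_.hallInv
    congr 1
    ext (j | j) <;> rfl

omit [BinomialRing R] in
theorem SamePolynomialInt.topPart {σ : Type*} {A : Fin N → (σ → ℤ) → ℤ}
    {A' : Fin N → (σ → R) → R} (hA : ∀ i, SamePolynomialInt (A i) (A' i)) (i : Fin N) :
    SamePolynomialInt (fun x => topPart w c (fun i => A i x) i)
      fun x => topPart w c (fun i => A' i x) i := by
  simp only [topPart_apply]
  by_cases h : w i = c
  · simpa only [h, if_true] using hA i
  · simpa only [h, if_false, Int.cast_zero] using SamePolynomialInt.const 0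

namespace IsHallBasicSequence

variable (hu : IsHallBasicSequence r c w u)
include hu

theorem hallMul_assoc (a b d : Fin N → R) :
    hallMul u (hallMul u a b) d = hallMul u a (hallMul u b d) := by
  let A (i : Fin N) : Fin N ⊕ Fin N ⊕ Fin N := .inl i
  let B (i : Fin N) : Fin N ⊕ Fin N ⊕ Fin N := .inr (.inl i)
  let D (i : Fin N) : Fin N ⊕ Fin N ⊕ Fin N := .inr (.inr i)
  have hA := fun i => SamePolynomialInt.coord (R := R) (A i)
  have hB := fun i => SamePolynomialInt.coord (R := R) (B i)
  have hD := fun i => SamePolynomialInt.coord (R := R) (D i)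
  ext i
  exact SamePolynomialInt.eq_of_eq
    (.hallMul (u := u) (fun i => .hallMul (u := u) hA hB i) hD i)
    (.hallMul (u := u) hA (fun i => .hallMul (u := u) hB hD i) i)
    (fun x => congrFun (hu.hallMul_assoc_int _ _ _) i) (Sum.elim a (Sum.elim b d))

theorem zero_hallMul (a : Fin N → R) : hallMul u 0 a = a := by
  ext i
  have h := SamePolynomialInt.eq_of_eq
    (.hallMul (u := u) (fun _ => .const 0) (fun i => .coord (R := R) i) i)
    (.coord i) (fun x => congrFun (hu.zero_hallMul_int x) i) a
  simp only [Int.cast_zero] at h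
  exact h

theorem hallMul_zero (a : Fin N → R) : hallMul u a 0 = a := by
  ext i
  have h := SamePolynomialInt.eq_of_eq
    (.hallMul (u := u) (fun i => .coord (R := R) i) (fun _ => .const 0) i)
    (.coord i) (fun x => congrFun (hu.hallMul_zero_int x) i) a
  simp only [Int.cast_zero] at h
  exact h

theorem hallInv_hallMul (a : Fin N → R) : hallMul u (hallInv u a) a = 0 := by
  ext i
  have h := SamePolynomialInt.eq_of_eq
    (.hallMul (u := u) (fun i => .hallInv (u := u) (fun i => .coord (R := R) i) i)
      (fun i => .coord (R := R) i) i)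
    (.const 0) (fun x => congrFun (hu.hallInv_hallMul_int x) i) a
  simp only [Int.cast_zero] at h
  exact h

theorem hallMul_add_topPart (a b z z' : Fin N → R) :
    hallMul u (a + topPart w c z) (b + topPart w c z') =
      hallMul u a b + topPart w c z + topPart w c z' := by
  let A (i : Fin N) : (Fin N ⊕ Fin N) ⊕ Fin N ⊕ Fin N := .inl (.inl i)
  let B (i : Fin N) : (Fin N ⊕ Fin N) ⊕ Fin N ⊕ Fin N := .inl (.inr i)
  let Z (i : Fin N) : (Fin N ⊕ Fin N) ⊕ Fin N ⊕ Fin N := .inr (.inl i)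
  let Z' (i : Fin N) : (Fin N ⊕ Fin N) ⊕ Fin N ⊕ Fin N := .inr (.inr i)
  have hA := fun i => SamePolynomialInt.coord (R := R) (A i)
  have hB := fun i => SamePolynomialInt.coord (R := R) (B i)
  have hZ := fun i => SamePolynomialInt.topPart (w := w) (c := c)
    (fun i => SamePolynomialInt.coord (R := R) (Z i)) i
  have hZ' := fun i => SamePolynomialInt.topPart (w := w) (c := c)
    (fun i => SamePolynomialInt.coord (R := R) (Z' i)) i
  ext i
  exact SamePolynomialInt.eq_of_eq
    (.hallMul (u := u) (fun i => (hA i).add (hZ i)) (fun i => (hB i).add (hZ' i)) i)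
    (((SamePolynomialInt.hallMul (u := u) hA hB i).add (hZ i)).add (hZ' i))
    (fun x => congrFun (hu.hallMul_add_topPart_int _ _ _ _) i)
    (Sum.elim (Sum.elim a b) (Sum.elim z z'))

theorem hallMul_apply_of_weight_one (hc : 1 ≤ c) (a b : Fin N → R) {i : Fin N} (hi : w i = 1) :
    hallMul u a b i = a i + b i := by
  let A (i : Fin N) : Fin N ⊕ Fin N := .inl i
  let B (i : Fin N) : Fin N ⊕ Fin N := .inr i
  have hA := fun i => SamePolynomialInt.coord (R := R) (A i)
  have hB := fun i => SamePolynomialInt.coord (R := R) (B i)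
  exact SamePolynomialInt.eq_of_eq (.hallMul (u := u) hA hB i) ((hA i).add (hB i))
    (fun x => hu.hallMul_apply_of_weight_one_int hc _ _ hi) (Sum.elim a b)

/-- An exponent tuple that commutes with the generators is supported in weight `c`. By induction on
the weight `k`, the coordinates of weight less than `k` vanish; those of weight `k` are then given
by the formula of `exists_exponent_formula`, whose right-hand side vanishes. The formula holds over
`R` because it is a polynomial identity once the coordinates of weight less than `k` are replaced
by zero. -/
theorem eq_zero_of_commute (hr : 2 ≤ r) {a : Fin N → R}
    (h : ∀ j : Level w 1, hallMul u a (Pi.single (j : Fin N) 1) =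
      hallMul u (Pi.single (j : Fin N) 1) a) : ∀ i, w i < c → a i = 0 := by
  suffices hk : ∀ k < c, ∀ i, w i = k → a i = 0 from fun i hi => hk (w i) hi i rfl
  intro k
  induction k using Nat.strong_induction_on with
  | _ k ih =>
  intro hkc i hi
  obtain ⟨ψ, hψ⟩ := hu.exists_exponent_formula hr (hi ▸ hu.one_le_weight i) hkc
  have hhigh : ∀ i, SamePolynomialInt (fun x : Fin N → ℤ => if w i < k then 0 else x i)
      fun x : Fin N → R => if w i < k then 0 else x i := fun i => by
    by_cases hi : w i < k
    · simpa only [hi, if_true, Int.cast_zero] using SamePolynomialInt.const 0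
    · simpa only [hi, if_false] using SamePolynomialInt.coord i
  have hsingle : ∀ j i : Fin N, SamePolynomialInt
      (fun _ : Fin N → ℤ => (Pi.single j 1 : Fin N → ℤ) i)
      fun _ : Fin N → R => (Pi.single j 1 : Fin N → R) i := fun j i => by
    by_cases hi : i = j
    · subst hi
      simpa only [Pi.single_eq_same, Int.cast_one] using SamePolynomialInt.const 1
    · simpa only [Pi.single_eq_of_ne hi, Int.cast_zero] using SamePolynomialInt.const 0
  have ha : (fun i => if w i < k then 0 else a i) = a := by
    ext i
    by_cases hi : w i < k
    · simp [hi, ih (w i) hi (by omega) i rfl]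
    · simp [hi]
  have key := SamePolynomial.eq_of_eq (hhigh i)
    (SamePolynomial.sum Finset.univ fun (j : Level w 1) _ =>
      SamePolynomial.sum Finset.univ fun (l : Level w (k + 1)) _ =>
      (SamePolynomial.sub (SamePolynomialInt.hallMul (u := u) hhigh (hsingle j) l)
        (SamePolynomialInt.hallMul (u := u) (hsingle j) hhigh l)).mul
          (SamePolynomial.const (ψ ⟨i, hi⟩ j l)))
    (fun x => hψ (fun i => if w i < k then 0 else x i) (fun i hi => if_pos hi) ⟨i, hi⟩) a
  simp only [ha, h, sub_self, zero_mul, Finset.sum_const_zero] at key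
  rw [congrFun ha i] at key
  exact (IsFractionRing.to_map_eq_zero_iff (R := R) (K := FractionRing R)).1 key

end IsHallBasicSequence

end Exponents

/-! ### Low parts, top parts and the deformation term -/

section Parts

variable {R : Type*} [CommRing R] {N c : ℕ} {w : Fin N → ℕ}

theorem lowPart_apply (a : Fin N → R) (i : Fin N) :
    lowPart w c a i = if w i < c then a i else 0 := rfl

theorem topPart_add (a b : Fin N → R) : topPart w c (a + b) = topPart w c a + topPart w c b := by
  ext i
  by_cases h : w i = c <;> simp [topPart_apply, h]

@[simp]
theorem topPart_topPart (a : Fin N → R) : topPart w c (topPart w c a) = topPart w c a := by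
  ext i
  by_cases h : w i = c <;> simp [topPart_apply, h]

theorem lowPart_add (a b : Fin N → R) : lowPart w c (a + b) = lowPart w c a + lowPart w c b := by
  ext i
  by_cases h : w i < c <;> simp [lowPart_apply, h]

@[simp]
theorem lowPart_lowPart (a : Fin N → R) : lowPart w c (lowPart w c a) = lowPart w c a := by
  ext i
  by_cases h : w i < c <;> simp [lowPart_apply, h]

@[simp]
theorem lowPart_topPart (a : Fin N → R) : lowPart w c (topPart w c a) = 0 := by
  ext i
  by_cases h : w i < c
  · simp [lowPart_apply, topPart_apply, h.ne]
  · simp [lowPart_apply, h]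

@[simp]
theorem lowPart_zero : lowPart w c (0 : Fin N → R) = 0 := by
  ext i
  simp [lowPart_apply]

@[simp]
theorem topPart_zero : topPart w c (0 : Fin N → R) = 0 := by
  ext i
  simp [topPart_apply]

@[simp]
theorem topPart_lowPart (a : Fin N → R) : topPart w c (lowPart w c a) = 0 := by
  ext i
  by_cases h : w i = c <;> simp [topPart_apply, lowPart_apply, h]

theorem lowPart_eq_zero_iff {a : Fin N → R} : lowPart w c a = 0 ↔ ∀ i, w i < c → a i = 0 := by
  simp [funext_iff, lowPart_apply]

theorem lowPart_add_topPart (hw : ∀ i, w i ≤ c) (a : Fin N → R) :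
    lowPart w c a + topPart w c a = a := by
  ext i
  rcases (hw i).lt_or_eq with h | h
  · simp [lowPart_apply, topPart_apply, h, h.ne]
  · simp [lowPart_apply, topPart_apply, h]

theorem topPart_eq_self (hw : ∀ i, w i ≤ c) {a : Fin N → R} (ha : lowPart w c a = 0) :
    topPart w c a = a := by
  simpa [ha] using lowPart_add_topPart hw a

variable {f : Level w 1 → R → R → Level w c → R}

theorem deformationTerm_apply (a b : Fin N → R) (i : Fin N) :
    deformationTerm w c f a b i =
      if h : w i = c then ∑ k : Level w 1, f k (a k) (b k) ⟨i, h⟩ else 0 := by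
  by_cases h : w i = c <;> simp [deformationTerm, extendLevel, h]

@[simp]
theorem topPart_deformationTerm (a b : Fin N → R) :
    topPart w c (deformationTerm w c f a b) = deformationTerm w c f a b := by
  ext i
  by_cases h : w i = c <;> simp [topPart_apply, deformationTerm_apply, h]

@[simp]
theorem lowPart_deformationTerm (a b : Fin N → R) :
    lowPart w c (deformationTerm w c f a b) = 0 := by
  rw [← topPart_deformationTerm, lowPart_topPart]

/-- The deformation term only involves the coordinates of weight one. -/
theorem deformationTerm_congr {a a' b b' : Fin N → R} (ha : ∀ i, w i = 1 → a i = a' i)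
    (hb : ∀ i, w i = 1 → b i = b' i) :
    deformationTerm w c f a b = deformationTerm w c f a' b' := by
  unfold deformationTerm
  congr 1
  exact Finset.sum_congr rfl fun k _ => by rw [ha k k.2, hb k k.2]

theorem lowPart_apply_of_weight_one (hc : 2 ≤ c) (a : Fin N → R) {i : Fin N} (hi : w i = 1) :
    lowPart w c a i = a i := by
  rw [lowPart_apply, if_pos (by omega)]

theorem deformationTerm_lowPart (hc : 2 ≤ c) (a b : Fin N → R) :
    deformationTerm w c f (lowPart w c a) (lowPart w c b) = deformationTerm w c f a b :=
  deformationTerm_congr (fun _ => lowPart_apply_of_weight_one hc a)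
    fun _ => lowPart_apply_of_weight_one hc b

theorem deformationTerm_congr_lowPart (hc : 2 ≤ c) {a a' b b' : Fin N → R}
    (ha : lowPart w c a = lowPart w c a') (hb : lowPart w c b = lowPart w c b') :
    deformationTerm w c f a b = deformationTerm w c f a' b' := by
  rw [← deformationTerm_lowPart hc a, ha, hb, deformationTerm_lowPart hc]

variable (hf : ∀ k, IsSymmTwoCocycle (f k))
include hf

theorem deformationTerm_comm (a b : Fin N → R) :
    deformationTerm w c f a b = deformationTerm w c f b a := by
  unfold deformationTerm
  congr 1
  exact Finset.sum_congr rfl fun k _ => (hf k).symm _ _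

theorem zero_deformationTerm (b : Fin N → R) : deformationTerm w c f 0 b = 0 := by
  ext i
  by_cases h : w i = c <;> simp [deformationTerm_apply, h, (hf _).zero_left]

theorem deformationTerm_zero (a : Fin N → R) : deformationTerm w c f a 0 = 0 := by
  rw [deformationTerm_comm hf, zero_deformationTerm hf]

theorem deformationTerm_cocycle (a b d : Fin N → R) :
    deformationTerm w c f (a + b) d + deformationTerm w c f a b =
      deformationTerm w c f a (b + d) + deformationTerm w c f b d := by
  ext i
  by_cases h : w i = c
  · simp only [Pi.add_apply, deformationTerm_apply, h, dif_pos, ← Finset.sum_add_distrib]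
    exact Finset.sum_congr rfl fun k _ => congrFun ((hf k).cocycle _ _ _) _
  · simp [deformationTerm_apply, h]

end Parts

/-! ### The deformed group law -/

section DeformedLaw

variable {G R : Type*} [Group G] [CommRing R] [BinomialRing R] [IsDomain R] [CharZero R]
  {N r c : ℕ} {w : Fin N → ℕ} {u : Fin N → G} {f : Level w 1 → R → R → Level w c → R}

omit [IsDomain R] [CharZero R] in
theorem lowPart_deformedMul (a b : Fin N → R) :
    lowPart w c (deformedMul u w c f a b) = lowPart w c (hallMul u a b) := by
  rw [deformedMul, lowPart_add, lowPart_deformationTerm, add_zero]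

namespace IsHallBasicSequence

variable (hu : IsHallBasicSequence r c w u)
include hu

theorem hallMul_topPart (a z : Fin N → R) :
    hallMul u a (topPart w c z) = a + topPart w c z := by
  simpa [hu.hallMul_zero] using hu.hallMul_add_topPart a 0 0 z

theorem topPart_hallMul (a z : Fin N → R) :
    hallMul u (topPart w c z) a = a + topPart w c z := by
  simpa [hu.zero_hallMul] using hu.hallMul_add_topPart 0 a z 0

/-- Only the low parts of the factors enter the product in a non-trivial way. -/
theorem hallMul_eq_add (a b : Fin N → R) :
    hallMul u a b =
      hallMul u (lowPart w c a) (lowPart w c b) + topPart w c a + topPart w c b := by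
  rw [← hu.hallMul_add_topPart, lowPart_add_topPart hu.weight_le, lowPart_add_topPart hu.weight_le]

theorem deformedMul_apply_of_weight_one (hc : 2 ≤ c) (a b : Fin N → R) {i : Fin N}
    (hi : w i = 1) : deformedMul u w c f a b i = (a + b) i := by
  rw [← lowPart_apply_of_weight_one hc (deformedMul u w c f a b) hi, lowPart_deformedMul,
    lowPart_apply_of_weight_one hc _ hi, hu.hallMul_apply_of_weight_one (by omega) a b hi,
    Pi.add_apply]

theorem hallInv_apply_of_weight_one (hc : 2 ≤ c) (a : Fin N → R) {i : Fin N} (hi : w i = 1) :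
    hallInv u a i = (-a) i := by
  have h := hu.hallMul_apply_of_weight_one (by omega) (hallInv u a) a hi
  rw [hu.hallInv_hallMul, Pi.zero_apply] at h
  exact eq_neg_of_add_eq_zero_left h.symm

theorem deformedInv_apply_of_weight_one (hc : 2 ≤ c) (a : Fin N → R) {i : Fin N} (hi : w i = 1) :
    deformedInv u w c f a i = (-a) i := by
  rw [deformedInv, Pi.sub_apply, deformationTerm_apply, dif_neg (by omega), sub_zero,
    hu.hallInv_apply_of_weight_one hc a hi]

variable (hf : ∀ k, IsSymmTwoCocycle (f k))
include hf

theorem deformedMul_assoc (hc : 2 ≤ c) (a b d : Fin N → R) :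
    deformedMul u w c f (deformedMul u w c f a b) d =
      deformedMul u w c f a (deformedMul u w c f b d) := by
  have h₁ := hu.hallMul_add_topPart (hallMul u a b) d (deformationTerm w c f a b) 0
  have h₂ := hu.hallMul_add_topPart a (hallMul u b d) 0 (deformationTerm w c f b d)
  have h₃ : deformationTerm w c f (deformedMul u w c f a b) d = deformationTerm w c f (a + b) d :=
    deformationTerm_congr (fun _ => hu.deformedMul_apply_of_weight_one hc a b) fun _ _ => rfl
  have h₄ : deformationTerm w c f a (deformedMul u w c f b d) = deformationTerm w c f a (b + d) :=
    deformationTerm_congr (fun _ _ => rfl) fun _ => hu.deformedMul_apply_of_weight_one hc b d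
  have h₅ := deformationTerm_cocycle hf a b d
  simp only [topPart_deformationTerm, topPart_zero, add_zero] at h₁ h₂
  rw [deformedMul, h₃, deformedMul, h₁, deformedMul, h₄, deformedMul, h₂, hu.hallMul_assoc,
    add_assoc, add_assoc, add_comm (deformationTerm w c f a b), h₅,
    add_comm (deformationTerm w c f b d)]

theorem zero_deformedMul (a : Fin N → R) : deformedMul u w c f 0 a = a := by
  rw [deformedMul, hu.zero_hallMul, zero_deformationTerm hf, add_zero]

theorem deformedInv_deformedMul (hc : 2 ≤ c) (a : Fin N → R) :
    deformedMul u w c f (deformedInv u w c f a) a = 0 := by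
  have h₁ := hu.hallMul_add_topPart (hallInv u a) a (-deformationTerm w c f a (-a)) 0
  have h₂ : deformationTerm w c f (deformedInv u w c f a) a = deformationTerm w c f (-a) a :=
    deformationTerm_congr (fun _ => hu.deformedInv_apply_of_weight_one hc a) fun _ _ => rfl
  have h₃ : topPart w c (-deformationTerm w c f a (-a)) = -deformationTerm w c f a (-a) := by
    rw [eq_neg_iff_add_eq_zero]
    nth_rw 2 [← topPart_deformationTerm]
    rw [← topPart_add, neg_add_cancel, topPart_zero]
  rw [h₃, topPart_zero, add_zero, add_zero, ← sub_eq_add_neg, hu.hallInv_hallMul, zero_add] at h₁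
  rw [deformedMul, h₂, deformedInv, h₁, deformationTerm_comm hf (-a) a, neg_add_cancel]

/-- The group structure of `N_{r,c}(R, f)`. -/
@[reducible]
noncomputable def deformationGroup (hc : 2 ≤ c) : Group (HallDeformation u w c f) :=
  letI : Mul (HallDeformation u w c f) := ⟨fun x y => ⟨deformedMul u w c f x.exponent y.exponent⟩⟩
  letI : One (HallDeformation u w c f) := ⟨⟨0⟩⟩
  letI : Inv (HallDeformation u w c f) := ⟨fun x => ⟨deformedInv u w c f x.exponent⟩⟩
  Group.ofLeftAxioms
    (fun x y z => HallDeformation.ext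
      (hu.deformedMul_assoc hf hc x.exponent y.exponent z.exponent))
    (fun x => HallDeformation.ext (hu.zero_deformedMul hf x.exponent))
    (fun x => HallDeformation.ext (hu.deformedInv_deformedMul hf hc x.exponent))

omit hf in
/-- The group structure of `N_{r,c}(R)`. -/
@[reducible]
noncomputable def completionGroup : Group (HallCompletion u R) :=
  letI : Mul (HallCompletion u R) := ⟨fun x y => ⟨hallMul u x.exponent y.exponent⟩⟩
  letI : One (HallCompletion u R) := ⟨⟨0⟩⟩
  letI : Inv (HallCompletion u R) := ⟨fun x => ⟨hallInv u x.exponent⟩⟩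
  Group.ofLeftAxioms
    (fun x y z => HallCompletion.ext (hu.hallMul_assoc x.exponent y.exponent z.exponent))
    (fun x => HallCompletion.ext (hu.zero_hallMul x.exponent))
    (fun x => HallCompletion.ext (hu.hallInv_hallMul x.exponent))

end IsHallBasicSequence

end DeformedLaw

/-! ### The extension by the centre -/

section Extension

variable {G R : Type*} [Group G] [CommRing R] [BinomialRing R] [IsDomain R] [CharZero R]
  {N r c : ℕ} {w : Fin N → ℕ} {u : Fin N → G} {f : Level w 1 → R → R → Level w c → R}

/-- The exponent tuple `p_c(a', b') + ∑ fⁱ(a_{1i}, b_{1i})` of the cocycle. -/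
noncomputable def cocycleExponent (u : Fin N → G) (w : Fin N → ℕ) (c : ℕ)
    (f : Level w 1 → R → R → Level w c → R) (a b : Fin N → R) : Fin N → R :=
  topPart w c (hallMul u (lowPart w c a) (lowPart w c b)) + deformationTerm w c f a b

omit [IsDomain R] [CharZero R] in
theorem topPart_cocycleExponent (a b : Fin N → R) :
    topPart w c (cocycleExponent u w c f a b) = cocycleExponent u w c f a b := by
  rw [cocycleExponent, topPart_add, topPart_topPart, topPart_deformationTerm]

omit [IsDomain R] [CharZero R] in
theorem lowPart_cocycleExponent (a b : Fin N → R) :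
    lowPart w c (cocycleExponent u w c f a b) = 0 := by
  rw [← topPart_cocycleExponent, lowPart_topPart]

omit [IsDomain R] [CharZero R] in
theorem cocycleExponent_congr (hc : 2 ≤ c) {a a' b b' : Fin N → R}
    (ha : lowPart w c a = lowPart w c a') (hb : lowPart w c b = lowPart w c b') :
    cocycleExponent u w c f a b = cocycleExponent u w c f a' b' := by
  rw [cocycleExponent, ha, hb, deformationTerm_congr_lowPart hc ha hb, cocycleExponent]

namespace IsHallBasicSequence

variable (hu : IsHallBasicSequence r c w u)
include hu

/-- The cocycle measures the failure of the top part to be a homomorphism. -/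
theorem topPart_deformedMul (a b : Fin N → R) :
    topPart w c (deformedMul u w c f a b) =
      topPart w c a + topPart w c b + cocycleExponent u w c f a b := by
  rw [deformedMul, hu.hallMul_eq_add, cocycleExponent]
  simp only [topPart_add, topPart_topPart, topPart_deformationTerm]
  abel

theorem cocycleExponent_cocycle (hc : 2 ≤ c) (hf : ∀ k, IsSymmTwoCocycle (f k))
    (a b d : Fin N → R) :
    cocycleExponent u w c f (hallMul u a b) d + cocycleExponent u w c f a b =
      cocycleExponent u w c f a (hallMul u b d) + cocycleExponent u w c f b d := by
  have h := congrArg (topPart w c) (hu.deformedMul_assoc hf hc a b d)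
  simp only [hu.topPart_deformedMul] at h
  rw [cocycleExponent_congr hc (lowPart_deformedMul a b) rfl,
    cocycleExponent_congr hc rfl (lowPart_deformedMul b d)] at h
  linear_combination h

theorem cocycleExponent_zero_left (hf : ∀ k, IsSymmTwoCocycle (f k)) (a : Fin N → R) :
    cocycleExponent u w c f 0 a = 0 := by
  have h := hu.topPart_deformedMul (f := f) 0 a
  rw [hu.zero_deformedMul hf, topPart_zero, zero_add] at h
  exact left_eq_add.1 h

theorem cocycleExponent_zero_right (hf : ∀ k, IsSymmTwoCocycle (f k)) (a : Fin N → R) :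
    cocycleExponent u w c f a 0 = 0 := by
  have h := hu.topPart_deformedMul (f := f) a 0
  rw [deformedMul, hu.hallMul_zero, deformationTerm_zero hf, topPart_zero, add_zero, add_zero] at h
  exact left_eq_add.1 h

section Completion

variable [Group (HallCompletion u R)]
  (hmul : ∀ a b : Fin N → R, (⟨a⟩ * ⟨b⟩ : HallCompletion u R) = ⟨hallMul u a b⟩)
include hmul

/-- The centre of `N_{r,c}(R)` consists of the products `u_c ^ v`. -/
theorem mem_center_completion_iff (hr : 2 ≤ r) {a : Fin N → R} :
    (⟨a⟩ : HallCompletion u R) ∈ Subgroup.center (HallCompletion u R) ↔ lowPart w c a = 0 := by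
  rw [Subgroup.mem_center_iff]
  constructor
  · intro h
    refine lowPart_eq_zero_iff.2 (hu.eq_zero_of_commute hr fun j => ?_)
    have := h ⟨Pi.single (j : Fin N) 1⟩
    rw [hmul, hmul] at this
    exact (congrArg HallCompletion.exponent this).symm
  · rintro h ⟨b⟩
    rw [hmul, hmul, ← topPart_eq_self hu.weight_le h, hu.hallMul_topPart, hu.topPart_hallMul]

theorem one_completion : (1 : HallCompletion u R) = ⟨0⟩ := by
  have h : (⟨0⟩ * ⟨0⟩ : HallCompletion u R) = ⟨0⟩ := by rw [hmul, hu.hallMul_zero]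
  exact (mul_eq_left.1 h).symm

theorem exponent_mul_of_center (hr : 2 ≤ r) (x y : Subgroup.center (HallCompletion u R)) :
    ((x * y : Subgroup.center (HallCompletion u R)) : HallCompletion u R).exponent =
      (x : HallCompletion u R).exponent + (y : HallCompletion u R).exponent := by
  obtain ⟨⟨a⟩, ha⟩ := x
  obtain ⟨⟨b⟩, hb⟩ := y
  have hb' := (hu.mem_center_completion_iff hmul hr).1 hb
  change ((⟨a⟩ * ⟨b⟩ : HallCompletion u R)).exponent = a + b
  rw [hmul, ← topPart_eq_self hu.weight_le hb', hu.hallMul_topPart]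

theorem mk_completion_eq_iff (hr : 2 ≤ r) {a b : Fin N → R} :
    (QuotientGroup.mk ⟨a⟩ : HallCompletion u R ⧸ Subgroup.center (HallCompletion u R)) =
      QuotientGroup.mk ⟨b⟩ ↔ lowPart w c a = lowPart w c b := by
  have key : ∀ z : Fin N → R, (⟨a⟩ * ⟨topPart w c z⟩ : HallCompletion u R) =
      ⟨a + topPart w c z⟩ := fun z => by rw [hmul, hu.hallMul_topPart]
  rw [QuotientGroup.eq]
  constructor
  · intro h
    obtain ⟨⟨z⟩, hz⟩ : ∃ z, z = (⟨a⟩ : HallCompletion u R)⁻¹ * ⟨b⟩ := ⟨_, rfl⟩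
    rw [← hz] at h
    have hz' := topPart_eq_self hu.weight_le ((hu.mem_center_completion_iff hmul hr).1 h)
    have := key z
    rw [hz', hz, mul_inv_cancel_left] at this
    obtain rfl : b = a + z := congrArg HallCompletion.exponent this
    rw [← hz', lowPart_add, lowPart_topPart, add_zero]
  · intro h
    have hb : b = a + topPart w c (b - a) := by
      rw [topPart_eq_self hu.weight_le, add_sub_cancel]
      rw [← add_left_inj (lowPart w c a), ← lowPart_add, sub_add_cancel, zero_add, h]
    rw [hb, ← key, inv_mul_cancel_left, hu.mem_center_completion_iff hmul hr, lowPart_topPart]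

/-- The low part of the exponents, as a function on the quotient by the centre. -/
noncomputable def quotientLowPart (hr : 2 ≤ r)
    (x : HallCompletion u R ⧸ Subgroup.center (HallCompletion u R)) : Fin N → R :=
  Quotient.liftOn x (fun a => lowPart w c a.exponent) fun _ _ h =>
    (hu.mk_completion_eq_iff hmul hr).1 (Quotient.sound h)

theorem quotientLowPart_mk (hr : 2 ≤ r) (a : Fin N → R) :
    hu.quotientLowPart hmul hr (QuotientGroup.mk ⟨a⟩) = lowPart w c a := rfl

/-- The cocycle `k` of the extension. -/
noncomputable def centralCocycle (hr : 2 ≤ r) (hc : 2 ≤ c) (hf : ∀ k, IsSymmTwoCocycle (f k)) :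
    CentralTwoCocycle (HallCompletion u R ⧸ Subgroup.center (HallCompletion u R))
      (Subgroup.center (HallCompletion u R)) where
  toFun x y := ⟨⟨cocycleExponent u w c f (hu.quotientLowPart hmul hr x)
    (hu.quotientLowPart hmul hr y)⟩,
    (hu.mem_center_completion_iff hmul hr).2 (lowPart_cocycleExponent _ _)⟩
  cocycle x y z := by
    obtain ⟨⟨a⟩, rfl⟩ := QuotientGroup.mk_surjective x
    obtain ⟨⟨b⟩, rfl⟩ := QuotientGroup.mk_surjective y
    obtain ⟨⟨d⟩, rfl⟩ := QuotientGroup.mk_surjective z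
    refine Subtype.ext (HallCompletion.ext ?_)
    rw [hu.exponent_mul_of_center hmul hr, hu.exponent_mul_of_center hmul hr,
      ← QuotientGroup.mk_mul, ← QuotientGroup.mk_mul, hmul, hmul]
    simp only [quotientLowPart_mk]
    have h := hu.cocycleExponent_cocycle hc hf a b d
    rwa [cocycleExponent_congr hc (lowPart_lowPart _) (lowPart_lowPart _),
      cocycleExponent_congr hc (lowPart_lowPart _) (lowPart_lowPart _),
      cocycleExponent_congr hc (lowPart_lowPart _) (lowPart_lowPart _),
      cocycleExponent_congr hc (lowPart_lowPart _) (lowPart_lowPart _)]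
  one_left x := by
    refine Subtype.ext ?_
    rw [Subgroup.coe_one, hu.one_completion hmul, ← QuotientGroup.mk_one, hu.one_completion hmul]
    simp only [quotientLowPart_mk, lowPart_zero, hu.cocycleExponent_zero_left hf]
  one_right x := by
    refine Subtype.ext ?_
    rw [Subgroup.coe_one, hu.one_completion hmul, ← QuotientGroup.mk_one, hu.one_completion hmul]
    simp only [quotientLowPart_mk, lowPart_zero, hu.cocycleExponent_zero_right hf]

theorem centralCocycle_mk (hr : 2 ≤ r) (hc : 2 ≤ c) (hf : ∀ k, IsSymmTwoCocycle (f k))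
    (a b : Fin N → R) :
    (((hu.centralCocycle hmul hr hc hf).toFun (QuotientGroup.mk ⟨a⟩) (QuotientGroup.mk ⟨b⟩) :
      Subgroup.center (HallCompletion u R)) : HallCompletion u R) =
      ⟨cocycleExponent u w c f a b⟩ :=
  congrArg HallCompletion.mk (cocycleExponent_congr hc (lowPart_lowPart _) (lowPart_lowPart _))

theorem mk_deformedMul (hr : 2 ≤ r) (a b : Fin N → R) :
    (QuotientGroup.mk ⟨deformedMul u w c f a b⟩ :
      HallCompletion u R ⧸ Subgroup.center (HallCompletion u R)) =
      QuotientGroup.mk ⟨a⟩ * QuotientGroup.mk ⟨b⟩ := by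
  rw [← QuotientGroup.mk_mul, hmul, hu.mk_completion_eq_iff hmul hr, lowPart_deformedMul]

variable [Group (HallDeformation u w c f)]
  (hdmul : ∀ a b : Fin N → R,
    (⟨a⟩ * ⟨b⟩ : HallDeformation u w c f) = ⟨deformedMul u w c f a b⟩)
include hdmul

omit hmul [Group (HallCompletion u R)] in
/-- The deformation has the same centre: by the symmetry of the cocycles, deformed products commute
exactly when the original ones do. -/
theorem mem_center_deformation_iff (hr : 2 ≤ r) (hf : ∀ k, IsSymmTwoCocycle (f k))
    {a : Fin N → R} :
    (⟨a⟩ : HallDeformation u w c f) ∈ Subgroup.center (HallDeformation u w c f) ↔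
      lowPart w c a = 0 := by
  have key : ∀ b : Fin N → R, (⟨b⟩ * ⟨a⟩ : HallDeformation u w c f) = ⟨a⟩ * ⟨b⟩ ↔
      hallMul u b a = hallMul u a b := fun b => by
    rw [hdmul, hdmul, HallDeformation.mk.injEq, deformedMul, deformedMul,
      deformationTerm_comm hf b a, add_left_inj]
  rw [Subgroup.mem_center_iff]
  constructor
  · intro h
    exact lowPart_eq_zero_iff.2 (hu.eq_zero_of_commute hr fun j => ((key _).1 (h ⟨_⟩)).symm)
  · rintro h ⟨b⟩
    rw [key, ← topPart_eq_self hu.weight_le h, hu.hallMul_topPart, hu.topPart_hallMul]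

/-- The extension `1 → Z(G) → N_{r,c}(R, f) → G/Z(G) → 1`. -/
noncomputable def deformationExtension (hr : 2 ≤ r) (hc : 2 ≤ c)
    (hf : ∀ k, IsSymmTwoCocycle (f k)) :
    GroupExtension (Subgroup.center (HallCompletion u R)) (HallDeformation u w c f)
      (HallCompletion u R ⧸ Subgroup.center (HallCompletion u R)) where
  inl := MonoidHom.mk' (fun z => ⟨(z : HallCompletion u R).exponent⟩) fun x y => by
    have hx := (hu.mem_center_completion_iff hmul hr).1 x.2
    rw [hdmul, hu.exponent_mul_of_center hmul hr, deformedMul,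
      ← topPart_eq_self hu.weight_le hx, hu.topPart_hallMul,
      deformationTerm_congr_lowPart hc (a' := 0) (lowPart_topPart _ |>.trans lowPart_zero.symm) rfl,
      zero_deformationTerm hf, add_zero, add_comm]
  rightHom := MonoidHom.mk' (fun x => QuotientGroup.mk ⟨x.exponent⟩) fun x y => by
    obtain ⟨a⟩ := x
    obtain ⟨b⟩ := y
    rw [hdmul]
    exact hu.mk_deformedMul hmul hr a b
  inl_injective := fun x y h =>
    Subtype.ext (HallCompletion.ext (congrArg HallDeformation.exponent h))
  range_inl_eq_ker_rightHom := by
    ext ⟨a⟩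
    rw [MonoidHom.mem_ker, MonoidHom.mk'_apply, QuotientGroup.eq_one_iff]
    exact ⟨fun ⟨z, hz⟩ => by
      rw [← congrArg HallDeformation.exponent hz]
      exact z.2, fun h => ⟨⟨⟨a⟩, h⟩, rfl⟩⟩
  rightHom_surjective := fun x => by
    obtain ⟨⟨a⟩, rfl⟩ := QuotientGroup.mk_surjective x
    exact ⟨⟨a⟩, rfl⟩

/-- The isomorphism `u ^ a ↦ (u ^ a Z(G), u_c ^ a_c)` with the extension given by the cocycle. -/
noncomputable def deformationExtensionEquiv (hr : 2 ≤ r) (hc : 2 ≤ c)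
    (hf : ∀ k, IsSymmTwoCocycle (f k)) :
    (hu.deformationExtension hmul hdmul hr hc hf).Equiv
      (hu.centralCocycle hmul hr hc hf).extension where
  toFun x := ⟨QuotientGroup.mk ⟨x.exponent⟩, ⟨⟨topPart w c x.exponent⟩,
    (hu.mem_center_completion_iff hmul hr).2 (lowPart_topPart _)⟩⟩
  invFun y := ⟨hu.quotientLowPart hmul hr y.base + (y.fiber : HallCompletion u R).exponent⟩
  left_inv x := HallDeformation.ext (lowPart_add_topPart hu.weight_le x.exponent)
  right_inv y := by
    obtain ⟨x, ⟨⟨z⟩, hz⟩⟩ := y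
    obtain ⟨⟨a⟩, rfl⟩ := QuotientGroup.mk_surjective x
    have hz' := (hu.mem_center_completion_iff hmul hr).1 hz
    refine CocycleExtension.ext ?_ (Subtype.ext (HallCompletion.ext ?_))
    · refine (hu.mk_completion_eq_iff hmul hr).2 ?_
      change lowPart w c (lowPart w c a + z) = lowPart w c a
      rw [lowPart_add, lowPart_lowPart, hz', add_zero]
    · change topPart w c (lowPart w c a + z) = z
      rw [topPart_add, topPart_eq_self hu.weight_le hz', topPart_lowPart, zero_add]
  map_mul' x y := by
    obtain ⟨a⟩ := x
    obtain ⟨b⟩ := y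
    rw [hdmul]
    refine CocycleExtension.ext (hu.mk_deformedMul hmul hr a b)
      (Subtype.ext (HallCompletion.ext ?_))
    rw [CocycleExtension.fiber_mul, hu.exponent_mul_of_center hmul hr,
      hu.exponent_mul_of_center hmul hr, hu.centralCocycle_mk hmul hr hc hf]
    exact hu.topPart_deformedMul a b
  inl_comm := by
    funext z
    have hz := (hu.mem_center_completion_iff hmul hr).1 z.2
    exact CocycleExtension.ext ((QuotientGroup.eq_one_iff _).2 z.2)
      (Subtype.ext (HallCompletion.ext (topPart_eq_self hu.weight_le hz)))
  rightHom_comm := rfl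

end Completion

end IsHallBasicSequence

end Extension

theorem mainTheorem9 {G R : Type*} [Group G] [CommRing R] [IsDomain R] [CharZero R]
    [BinomialRing R] {N : ℕ} (r c : ℕ) (hr : 2 ≤ r) (hc : 2 ≤ c)
    (w : Fin N → ℕ) (u : Fin N → G) (hu : IsHallBasicSequence r c w u)
    (f : Level w 1 → R → R → Level w c → R) (hf : ∀ k, IsSymmTwoCocycle (f k)) :
    -- `𝒢` is the group structure of `N_{r,c}(R)`, `ℋ` that of `N_{r,c}(R, f)`
    ∃ (𝒢 : Group (HallCompletion u R)) (ℋ : Group (HallDeformation u w c f)),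
      (∀ a b : Fin N → R,
        (⟨a⟩ * ⟨b⟩ : HallCompletion u R) = ⟨hallMul u a b⟩) ∧
      (∀ a : Fin N → R, (⟨a⟩ : HallCompletion u R)⁻¹ = ⟨hallInv u a⟩) ∧
      (∀ a b : Fin N → R,
        (⟨a⟩ * ⟨b⟩ : HallDeformation u w c f) = ⟨deformedMul u w c f a b⟩) ∧
      (∀ a : Fin N → R, (⟨a⟩ : HallDeformation u w c f)⁻¹ = ⟨deformedInv u w c f a⟩) ∧
      ∃ (k : CentralTwoCocycle
            (HallCompletion u R ⧸ Subgroup.center (HallCompletion u R))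
            (Subgroup.center (HallCompletion u R)))
        (S : GroupExtension (Subgroup.center (HallCompletion u R)) (HallDeformation u w c f)
            (HallCompletion u R ⧸ Subgroup.center (HallCompletion u R)))
        (e : S.Equiv k.extension),
        -- the explicit cocycle `k(u^a Z(G), u^b Z(G)) = u_c ^ (p_c(a', b') + ∑ fⁱ(a_{1i}, b_{1i}))`
        (∀ a b : Fin N → R,
          (k.toFun (QuotientGroup.mk ⟨a⟩) (QuotientGroup.mk ⟨b⟩) : HallCompletion u R) =
            ⟨topPart w c (hallMul u (lowPart w c a) (lowPart w c b)) +
              deformationTerm w c f a b⟩) ∧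
        -- the maps `u^z ↦ u^z` and `u^a ↦ u^a Z(G)` of the extension
        (∀ z : Subgroup.center (HallCompletion u R),
          S.inl z = ⟨(z : HallCompletion u R).exponent⟩) ∧
        (∀ a : Fin N → R, S.rightHom ⟨a⟩ = QuotientGroup.mk ⟨a⟩) ∧
        -- the extension is central, and `Z(G)` is mapped onto the whole centre
        S.inl.range = Subgroup.center (HallDeformation u w c f) ∧
        -- the isomorphism with `E(k)` is `u^a ↦ (u^a Z(G), u_c ^ a_c)`
        (∀ a : Fin N → R,
          (e ⟨a⟩).base = QuotientGroup.mk ⟨a⟩ ∧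
          ((e ⟨a⟩).fiber : HallCompletion u R) = ⟨topPart w c a⟩) := by
  let 𝒢 : Group (HallCompletion u R) := hu.completionGroup
  let ℋ : Group (HallDeformation u w c f) := hu.deformationGroup hf hc
  have hmul : ∀ a b : Fin N → R, (⟨a⟩ * ⟨b⟩ : HallCompletion u R) = ⟨hallMul u a b⟩ :=
    fun _ _ => rfl
  have hdmul : ∀ a b : Fin N → R,
      (⟨a⟩ * ⟨b⟩ : HallDeformation u w c f) = ⟨deformedMul u w c f a b⟩ := fun _ _ => rfl
  refine ⟨𝒢, ℋ, hmul, fun _ => rfl, hdmul, fun _ => rfl, hu.centralCocycle hmul hr hc hf,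
    hu.deformationExtension hmul hdmul hr hc hf, hu.deformationExtensionEquiv hmul hdmul hr hc hf,
    hu.centralCocycle_mk hmul hr hc hf, fun _ => rfl, fun _ => rfl, ?_, fun _ => ⟨rfl, rfl⟩⟩
  ext ⟨a⟩
  rw [hu.mem_center_deformation_iff hdmul hr hf, ← hu.mem_center_completion_iff hmul hr]
  exact ⟨fun ⟨z, hz⟩ => by
    obtain rfl : (z : HallCompletion u R).exponent = a := congrArg HallDeformation.exponent hz
    exact z.2, fun h => ⟨⟨⟨a⟩, h⟩, rfl⟩⟩
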